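/- **Setting.** Let $\mathbf y=\mathbf X\boldsymbol\beta+\boldsymbol\varepsilon$ with a deterministic design $\mathbf X=(\mathbf x_1,\dots,\mathbf x_p)\in\mathbb R^{n\times p}$, $\|\mathbf x_j\|^2=n$ for all $j$, and $\boldsymbol\varepsilon\sim N(0,\sigma^2\mathbf I_n)$, $\sigma>0$. No relation between $p$ and $n$ is assumed ($p\gg n$ is allowed). Let $A^o=\{j:\beta_j\neq0\}$, $d^o=|A^o|$, $\beta_*=\min_{j\in A^o}|\beta_j|$ ($=+\infty$ if $A^o=\emptyset$), $\boldsymbol\Sigma_A=\mathbf X_A'\mathbf X_A/n$, and let $w^o$ be the largest diagonal element of $\boldsymbol\Sigma_{A^o}^{-1}$. The oracle least squares estimator is $\hat{\boldsymbol\beta}^o=\arg\min_{\mathbf b}\{\|\mathbf y-\mathbf X\mathbf b\|^2: b_j=0\ \forall j\notin A^o\}$. Let $\rho(t;\lambda)=\lambda\int_0^t(1-x/(\gamma\lambda))_+\,dx$ be the minimax concave penalty, with derivative $\dot\rho(t;\lambda)$ in $t$. Call $(\lambda,\mathbf b)$, $\lambda\ge0$, a critical point if $\mathbf x_j'(\mathbf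 y-\mathbf X\mathbf b)/n=\mathrm{sgn}(b_j)\dot\rho(|b_j|;\lambda)$ whenever $b_j\ne0$ and $|\mathbf x_j'(\mathbf y-\mathbf X\mathbf b)/n|\le\lambda$ whenever $b_j=0$. Let $x\mapsto(\lambda^{(x)},\hat{\boldsymbol\beta}^{(x)})$, $x\ge0$, be a continuous path of critical points with $\hat{\boldsymbol\beta}^{(0)}=\mathbf 0$ and $\lim_{x\to\infty}\lambda^{(x)}=0$. The MC+ estimator at level $\lambda>0$ is $\hat{\boldsymbol\beta}(\lambda)=\hat{\boldsymbol\beta}^{(x_\lambda)}$ with $x_\lambda=\inf\{x\ge0:\lambda^{(x)}\le\lambda\}$. Let $\hat{\boldsymbol\beta}=\hat{\boldsymbol\beta}(\hat\lambda)$ with a deterministic or random $\hat\lambda$, and let $\hat A=\{j:\hat\beta_j\ne0\}$. Assume the sparse Riesz condition with an integer $1\le d^*\le p$ and $0<c_*\le c^*<\infty$: for all $A$ with $|A|\le d^*$, $\|\boldsymbol\Sigma_A\mathbf u\|\ge c_*$ for all unit vectors $\mathbf u$, and the largest eigenvalue of $\boldsymbol\Sigma_A$ is at most $c^*$. Assume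 $d^o\le d^*/(c^*/c_*+1/2)$ and $\gamma\ge c_*^{-1}\sqrt{4+c_*/c^*}$. Let $\epsilon\in(0,1]$, $m=d^*-d^o$, and let $\tilde p_\epsilon$ be the unique solution with $2\log\tilde p_\epsilon\ge1$ of $$2\log\tilde p_\epsilon-1-\log(2\log\tilde p_\epsilon)=\frac2m\Big\{\log\binom{p-d^o}{m}+\log(1/\epsilon)\Big\}.$$ Put $\lambda_{1,\epsilon}=\sigma\sqrt{(2/n)\log((p-d^o)/\epsilon)}$, let $\lambda_{2,\epsilon}\ge\max\{2\sqrt{c^*}\,\sigma\sqrt{(2/n)\log\tilde p_\epsilon},\ \lambda_{1,\epsilon}\}$, and assume $\beta_*\ge\sigma\sqrt{w^o(2/n)\log(d^o/\epsilon)}+\gamma\lambda_{2,\epsilon}$ (no condition if $A^o=\emptyset$). **Theorem 1.** (i) Under these assumptions $$P\{\hat{\boldsymbol\beta}\ne\hat{\boldsymbol\beta}^o\ \text{or}\ \mathrm{sgn}(\hat{\boldsymbol\beta})\ne\mathrm{sgn}(\boldsymbol\beta)\}\le P\{\hat\lambda\notin[\lambda_{1,\epsilon},\lambda_{2,\epsilon}]\}+\Big(\frac32+\frac1{\sqrt2}\Big)\epsilon.$$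 (ii) Consider a sequence of such models, in which all quantities, including $n,p,d^*,c_*,c^*,\gamma,d^o,\boldsymbol\beta,\sigma$ and $\epsilon$, may vary along the sequence. If $P\{\lambda_{1,\epsilon}\le\hat\lambda\le\lambda_{2,\epsilon}\}\to1$ and $$\max\Big\{\epsilon^{-1},\ \min\big\{p-d^o,\ \tilde p_1,\ \sqrt{n/w^o}\,(\beta_*-\gamma\lambda_{2,\epsilon})/\sigma\big\}\Big\}\to\infty$$ (the last entry of the minimum being $+\infty$ if $A^o=\emptyset$), then $P\{\hat A=A^o\}\to1$, and the MC+ estimator is asymptotically as efficient as the oracle: $P\{\hat{\boldsymbol\beta}\ne\hat{\boldsymbol\beta}^o\ \text{or}\ \mathrm{sgn}(\hat{\boldsymbol\beta})\ne\mathrm{sgn}(\boldsymbol\beta)\}\to0$, so that $\sup_S|P\{\hat{\boldsymbol\beta}\in S\}-P\{\hat{\boldsymbol\beta}^o\in S\}|\to0$. -/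

import Mathlib

open MeasureTheory ProbabilityTheory Filter Topology Matrix

noncomputable section

namespace MCPlus

/-! ## Design matrix, Gram matrices, sparse Riesz condition -/

section Design

variable {n p : ℕ}

/-- The normalized Gram matrix `Xᵀ X / n`. -/
def gram (X : Matrix (Fin n) (Fin p) ℝ) : Matrix (Fin p) (Fin p) ℝ :=
  (n : ℝ)⁻¹ • (Xᵀ * X)

/-- The normalized Gram matrix of the columns of `X` with index in `A`. -/
def subGram (X : Matrix (Fin n) (Fin p) ℝ) (A : Finset (Fin p)) : Matrix A A ℝ :=
  (gram X).submatrix Subtype.val Subtype.val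

/-- The sparse Riesz condition with rank `dS` and constants `cL`, `cU`: for every set `A` of at
most `dS` columns, `‖Σ_A u‖ ≥ cL` for all Euclidean unit vectors `u`, and the largest eigenvalue
of `Σ_A` is at most `cU`. -/
def SparseRiesz (X : Matrix (Fin n) (Fin p) ℝ) (dS : ℕ) (cL cU : ℝ) : Prop :=
  ∀ A : Finset (Fin p), A.card ≤ dS →
    (∀ u : EuclideanSpace ℝ A, ‖u‖ = 1 → cL ≤ ‖Matrix.toEuclideanLin (subGram X A) u‖) ∧
    (∀ c : ℝ, Module.End.HasEigenvalue (Matrix.toLin' (subGram X A)) c → c ≤ cU)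

/-- The support `A° = {j : β_j ≠ 0}`. -/
def supp (β : Fin p → ℝ) : Finset (Fin p) := Finset.univ.filter fun j => β j ≠ 0

/-- The largest diagonal element of `Σ_A⁻¹` (meaningful for nonempty `A`). -/
def maxDiagInv (X : Matrix (Fin n) (Fin p) ℝ) (A : Finset (Fin p)) : ℝ :=
  ⨆ j : A, (subGram X A)⁻¹ j j

/-- The response vector `y = X β + noise`. -/
def response (X : Matrix (Fin n) (Fin p) ℝ) (β : Fin p → ℝ) (e : EuclideanSpace ℝ (Fin n)) :
    Fin n → ℝ :=
  fun i => (X *ᵥ β) i + e i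

/-- `b` is a least squares estimator among the vectors supported in `B`. -/
def IsOracleLSE (X : Matrix (Fin n) (Fin p) ℝ) (y : Fin n → ℝ) (B : Finset (Fin p))
    (b : Fin p → ℝ) : Prop :=
  (∀ j, j ∉ B → b j = 0) ∧
    ∀ b' : Fin p → ℝ, (∀ j, j ∉ B → b' j = 0) →
      ∑ i, (y i - (X *ᵥ b) i) ^ 2 ≤ ∑ i, (y i - (X *ᵥ b') i) ^ 2

end Design

/-! ## The minimax concave penalty and the MC+ selector -/

/-- The minimax concave penalty `ρ(t; lam) = lam ∫_0^t (1 - x / (γ lam))_+ dx`. -/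
def mcp (γ lam t : ℝ) : ℝ := lam * ∫ x in (0 : ℝ)..t, max (1 - x / (γ * lam)) 0

/-- The derivative in `t` of the minimax concave penalty. -/
def mcpDeriv (γ lam t : ℝ) : ℝ := lam * max (1 - t / (γ * lam)) 0

theorem hasDerivAt_mcp (γ lam t : ℝ) : HasDerivAt (mcp γ lam) (mcpDeriv γ lam t) t := by
  have hc : Continuous fun x : ℝ => max (1 - x / (γ * lam)) 0 := by fun_prop
  exact (hc.integral_hasStrictDerivAt 0 t).hasDerivAt.const_mul lam

section Path

variable {n p : ℕ}

/-- `(lam, b)` is a critical point of the loss `‖y - X b‖² / (2 n) + ∑ j, ρ(|b_j|; lam)` with the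
minimax concave penalty, at penalty level `lam ≥ 0`. -/
def IsCriticalPoint (γ : ℝ) (X : Matrix (Fin n) (Fin p) ℝ) (y : Fin n → ℝ)
    (lam : ℝ) (b : Fin p → ℝ) : Prop :=
  0 ≤ lam ∧ ∀ j,
    (b j ≠ 0 → (Xᵀ *ᵥ (y - X *ᵥ b)) j / n = Real.sign (b j) * mcpDeriv γ lam |b j|) ∧
    (b j = 0 → |(Xᵀ *ᵥ (y - X *ᵥ b)) j / n| ≤ lam)

/-- A main branch of the solution graph: a continuous path `x ↦ (lamP x, bP x)`, `x ≥ 0`, of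
critical points which starts at `b = 0` and along which the penalty level tends to zero. -/
structure IsMainBranch (γ : ℝ) (X : Matrix (Fin n) (Fin p) ℝ) (y : Fin n → ℝ)
    (lamP : ℝ → ℝ) (bP : ℝ → Fin p → ℝ) : Prop where
  continuousOn_lam : ContinuousOn lamP (Set.Ici 0)
  continuousOn_b : ContinuousOn bP (Set.Ici 0)
  critical : ∀ x, 0 ≤ x → IsCriticalPoint γ X y (lamP x) (bP x)
  start : bP 0 = 0
  tendsto_lam : Tendsto lamP atTop (𝓝 0)

/-- The first parameter at which the path reaches the penalty level `lam`
(for `lam > 0` the infimum is over a nonempty set and is attained). -/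
def firstHit (lamP : ℝ → ℝ) (lam : ℝ) : ℝ := sInf {x : ℝ | 0 ≤ x ∧ lamP x ≤ lam}

/-- `b` is the value `β̂(lam)` of the MC+ selector for the data `(X, y)`: the point of a main branch
at which the penalty level `lam > 0` is first reached. -/
def IsMCPlus (γ : ℝ) (X : Matrix (Fin n) (Fin p) ℝ) (y : Fin n → ℝ)
    (lam : ℝ) (b : Fin p → ℝ) : Prop :=
  ∃ (lamP : ℝ → ℝ) (bP : ℝ → Fin p → ℝ),
    IsMainBranch γ X y lamP bP ∧ b = bP (firstHit lamP lam)

end Path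

/-! ## The penalty levels -/

/-- The defining equation of `q = p̃_ε`, on the branch `2 log q ≥ 1`. -/
def IsPTilde (p d m : ℕ) (ε q : ℝ) : Prop :=
  0 < q ∧ 1 ≤ 2 * Real.log q ∧
    2 * Real.log q - 1 - Real.log (2 * Real.log q)
      = (2 / (m : ℝ)) * (Real.log ((p - d).choose m : ℝ) + Real.log (1 / ε))

/-- `p̃_ε`, the unique solution of `IsPTilde` (see `isPTilde_iff`). -/
def pTilde (p d m : ℕ) (ε : ℝ) : ℝ := sSup {q : ℝ | IsPTilde p d m ε q}

/-- For `1 ≤ m ≤ p - d` and `0 < ε ≤ 1`, `pTilde` is the unique solution of its equation. -/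
theorem isPTilde_iff {p d m : ℕ} {ε : ℝ} (hmp : m ≤ p - d) (hε : 0 < ε) (hε1 : ε ≤ 1) (q : ℝ) :
    IsPTilde p d m ε q ↔ q = pTilde p d m ε := by
  set R : ℝ := (2 / (m : ℝ)) * (Real.log ((p - d).choose m : ℝ) + Real.log (1 / ε)) with hR
  have hR0 : 0 ≤ R := by
    refine mul_nonneg (by positivity) (add_nonneg (Real.log_nonneg ?_) (Real.log_nonneg ?_))
    · exact_mod_cast Nat.choose_pos hmp
    · rw [le_div_iff₀ hε]; linarith
  obtain ⟨s, hs1, hs⟩ : ∃ s : ℝ, 1 ≤ s ∧ s - 1 - Real.log s = R := by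
    have hcont : ContinuousOn (fun s : ℝ => s - 1 - Real.log s) (Set.Icc 1 (2 * R + 2)) := by
      refine ContinuousOn.sub (by fun_prop) (Real.continuousOn_log.mono ?_)
      intro x hx
      have h1 : (1 : ℝ) ≤ x := hx.1
      simp only [Set.mem_compl_iff, Set.mem_singleton_iff]
      linarith
    have hmem : R ∈ Set.Icc ((fun s : ℝ => s - 1 - Real.log s) 1)
        ((fun s : ℝ => s - 1 - Real.log s) (2 * R + 2)) := by
      refine ⟨by simpa using hR0, ?_⟩
      have h1 : Real.log (2 * R + 2) = Real.log 2 + Real.log (R + 1) := by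
        rw [← Real.log_mul (by norm_num) (by linarith)]; congr 1; ring
      have h2 := Real.log_le_sub_one_of_pos (show (0 : ℝ) < R + 1 by linarith)
      have h3 := Real.log_le_sub_one_of_pos (show (0 : ℝ) < 2 by norm_num)
      simp only [h1]
      linarith
    obtain ⟨s, hs, hsR⟩ := intermediate_value_Icc (by linarith) hcont hmem
    exact ⟨s, hs.1, hsR⟩
  have huniq : ∀ t : ℝ, 1 ≤ t → t - 1 - Real.log t = R → t = s := by
    have key : ∀ a b : ℝ, 1 ≤ a → a < b → a - 1 - Real.log a < b - 1 - Real.log b := by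
      intro a b ha hab
      have hr : 1 < b / a := (one_lt_div (by linarith)).2 hab
      have h1 := Real.log_lt_sub_one_of_pos (show 0 < b / a by linarith) hr.ne'
      rw [Real.log_div (by linarith) (by linarith)] at h1
      have h2 : b / a - 1 ≤ b - a := by
        rw [div_sub_one (by linarith), div_le_iff₀ (by linarith)]
        nlinarith
      linarith
    intro t ht1 ht
    rcases lt_trichotomy t s with h | h | h
    · have := key t s ht1 h; linarith
    · exact h
    · have := key s t hs1 h; linarith
  have hall : ∀ q : ℝ, IsPTilde p d m ε q ↔ q = Real.exp (s / 2) := by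
    intro q
    constructor
    · rintro ⟨hq, hq1, hq2⟩
      have := huniq _ hq1 hq2
      rw [← this, show 2 * Real.log q / 2 = Real.log q by ring, Real.exp_log hq]
    · rintro rfl
      have h2 : 2 * (s / 2) = s := by ring
      refine ⟨Real.exp_pos _, ?_, ?_⟩
      · rw [Real.log_exp, h2]; exact hs1
      · rw [Real.log_exp, h2]; exact hs
  have hset : {q : ℝ | IsPTilde p d m ε q} = {Real.exp (s / 2)} := by
    ext q; simp [hall q]
  rw [hall q, pTilde, hset, csSup_singleton]

/-- `λ_{1,ε} = σ √((2/n) log((p - d)/ε))`. -/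
def lamOne (n p d : ℕ) (σ ε : ℝ) : ℝ :=
  σ * Real.sqrt ((2 / (n : ℝ)) * Real.log (((p : ℝ) - d) / ε))

/-! ## The assumptions -/

/-- The standing assumptions, for the linear model `y = X β + noise` with Gaussian errors,
a deterministic or random penalty level `lamHat`, the MC+ estimator `betaHat = β̂(lamHat)` and the
oracle least squares estimator `oracle`. -/
structure Setting {Ω : Type*} [MeasurableSpace Ω] (P : Measure Ω) {n p : ℕ}
    (X : Matrix (Fin n) (Fin p) ℝ) (β : Fin p → ℝ) (σ : ℝ)
    (noise : Ω → EuclideanSpace ℝ (Fin n)) (dS : ℕ) (cL cU γ ε lam2 : ℝ)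
    (lamHat : Ω → ℝ) (betaHat oracle : Ω → Fin p → ℝ) : Prop where
  sigma_pos : 0 < σ
  noise_law : HasLaw noise (multivariateGaussian 0 (σ ^ 2 • (1 : Matrix (Fin n) (Fin n) ℝ))) P
  column_norm : ∀ j, ∑ i, X i j ^ 2 = n
  rank_pos : 1 ≤ dS
  rank_le : dS ≤ p
  cL_pos : 0 < cL
  cL_le_cU : cL ≤ cU
  sparse_riesz : SparseRiesz X dS cL cU
  sparsity : ((supp β).card : ℝ) ≤ dS / (cU / cL + 1 / 2)
  gamma_ge : cL⁻¹ * Real.sqrt (4 + cL / cU) ≤ γ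
  eps_pos : 0 < ε
  eps_le_one : ε ≤ 1
  lam2_ge : max (2 * Real.sqrt cU *
      (σ * Real.sqrt ((2 / (n : ℝ)) *
        Real.log (pTilde p (supp β).card (dS - (supp β).card) ε))))
      (lamOne n p (supp β).card σ ε) ≤ lam2
  /-- The lower bound on `β_* = min {|β_j| : β_j ≠ 0}` (no condition if `β = 0`). -/
  signal_ge : ∀ j ∈ supp β,
    σ * Real.sqrt (maxDiagInv X (supp β) * (2 / (n : ℝ)) * Real.log ((supp β).card / ε))
      + γ * lam2 ≤ |β j|
  /-- `betaHat` is the MC+ selector at the penalty level `lamHat`. -/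
  mcPlus : ∀ᵐ ω ∂P, 0 < lamHat ω →
    IsMCPlus γ X (response X β (noise ω)) (lamHat ω) (betaHat ω)
  /-- `oracle` is the least squares estimator with the oracular choice `B = A°`. -/
  oracle_lse : ∀ᵐ ω ∂P, IsOracleLSE X (response X β (noise ω)) (supp β) (oracle ω)

/-- The event that `betaHat` differs from the oracle or has a wrong sign in some coordinate. -/
def failure {Ω : Type*} {p : ℕ} (β : Fin p → ℝ) (betaHat oracle : Ω → Fin p → ℝ) : Set Ω :=
  {ω | betaHat ω ≠ oracle ω ∨ ∃ j, Real.sign (betaHat ω j) ≠ Real.sign (β j)}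

end MCPlus

end

/-!
The proof has a deterministic and a probabilistic half. Let `B` be the support of `β`, `d` its
size, `m = dS - d`, and let `b°` be the oracle.

*Deterministic half.* A coordinate outside `B` is tight for a critical point at level `lam` if its
score `g` satisfies `|g| + |b| / γ ≥ lam`; active coordinates are tight. Suppose that a critical
point at a level `lam ≥ lam2` is supported in a set `A ⊇ B` of size `dS`, and that all `m`
coordinates of `A` outside `B` are tight. With `b̄` the least squares fit on `A`, `w = b̄ - b` and
`c = b - b°`, the score of `b` on `A` is `Σ_A w`, while `X (w + c)` is the projection of the noise
to a space of dimension `m`, hence small. Diagonalizing `Σ_A` bounds `‖X (w + c)‖² / n` below by a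
sum over the coordinates of quadratic forms in the score and in `c`
(`SparseRiesz.sum_quadratic_le`, `quadratic_bound_weight`); tight coordinates contribute much and
those in `B` little below zero, and the sparsity assumption makes the two bounds incompatible
(`SparseRiesz.not_all_tight`). So along the main branch the number of active coordinates outside
`B` cannot pass through `m`, and it stays below `m`. On sparse vectors the loss is more convex
than the penalty is concave, so at a level between `lamOne` and `lam2` the only sparse critical
point is the oracle (`SparseRiesz.eq_oracle_of_critical`). A connectedness argument along the path
combines the two facts (`SparseRiesz.mcPlus_eq_oracle`).

*Probabilistic half.* The deterministic argument needs that the residual scores of the oracle are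
below `lamOne`, that its coefficients are beyond `γ * lam2` with the correct sign, and that the
projections of the noise to the spaces `extraSpan X A B` are small. The first two events concern
Gaussian variables, the third chi-square variables with `m` degrees of freedom. In both cases the
exponential tail bound holds with an additional factor that is at most `1 / 2` and tends to zero
with growing threshold (`gaussianReal_Ici_le`, `stdGaussian_norm_sq_tail`). For the chi-square
tail the logarithm of the rescaled variable has density proportional to `exp (a * (x - exp x))`,
`a = m / 2`, whose right half is dominated by the reflected left half. The union bound
(`Setting.measure_failure_le`) then gives at most `2 * ε` for `ε < 1`, and a vanishing bound under
the growth condition even if `ε` does not vanish.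
-/

namespace MCPlus

open scoped RealInnerProductSpace

/-! ### Spectral estimates under the sparse Riesz condition -/

/-- A quadratic form in `(T w, c)` is dominated by `⟪T (w + c), w + c⟫` as soon as this holds for
every scalar of the spectral interval in place of `T`. -/
theorem quadratic_le_of_spectrum {E : Type*} [NormedAddCommGroup E] [InnerProductSpace ℝ E]
    [FiniteDimensional ℝ E] {T : E →ₗ[ℝ] E} (hT : T.IsSymmetric) {l u : ℝ}
    (hev : ∀ x, Module.End.HasEigenvalue T x → l ≤ x ∧ x ≤ u) {α μ δ : ℝ}
    (hq : ∀ x, l ≤ x → x ≤ u → ∀ r s : ℝ,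
      α * (x * r) ^ 2 + 2 * μ * (x * r) * s + δ * s ^ 2 ≤ x * (r + s) ^ 2) (w c : E) :
    α * ‖T w‖ ^ 2 + 2 * μ * ⟪T w, c⟫ + δ * ‖c‖ ^ 2 ≤ ⟪T (w + c), w + c⟫ := by
  set b := hT.eigenvectorBasis rfl with hb
  have hTb : ∀ (i) (v : E), ⟪b i, T v⟫ = hT.eigenvalues rfl i * ⟪b i, v⟫ := by
    intro i v
    rw [← hT, hb, hT.apply_eigenvectorBasis, real_inner_smul_left]
    rfl
  have hexp : ∀ v v' : E, ⟪v, v'⟫ = ∑ i, ⟪b i, v⟫ * ⟪b i, v'⟫ := by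
    intro v v'
    rw [← b.sum_inner_mul_inner]
    simp_rw [real_inner_comm]
  rw [← real_inner_self_eq_norm_sq, ← real_inner_self_eq_norm_sq, hexp (T w), hexp (T w) c,
    hexp c, hexp (T (w + c)), Finset.mul_sum, Finset.mul_sum, Finset.mul_sum,
    ← Finset.sum_add_distrib, ← Finset.sum_add_distrib]
  refine Finset.sum_le_sum fun i _ => ?_
  have h := hev _ (hT.hasEigenvalue_eigenvalues rfl i)
  have := hq _ h.1 h.2 ⟪b i, w⟫ ⟪b i, c⟫
  simp only [hTb, inner_add_right]
  simp only [RCLike.ofReal_real_eq_id, id] at *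
  nlinarith [this]

section Geometry

variable {n p : ℕ}

/-- The `j`-th column of the design, as a vector of the Euclidean space. -/
noncomputable def xcol (X : Matrix (Fin n) (Fin p) ℝ) (j : Fin p) : EuclideanSpace ℝ (Fin n) :=
  WithLp.toLp 2 fun i => X i j

/-- The linear map `b ↦ X b` into the Euclidean space. -/
noncomputable def fit (X : Matrix (Fin n) (Fin p) ℝ) :
    (Fin p → ℝ) →ₗ[ℝ] EuclideanSpace ℝ (Fin n) :=
  (WithLp.linearEquiv 2 ℝ (Fin n → ℝ)).symm.toLinearMap ∘ₗ X.mulVecLin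

/-- The coordinates `x_jᵀ v / n` of the normalized correlation of `v` with the columns. -/
noncomputable def corr (X : Matrix (Fin n) (Fin p) ℝ) (v : EuclideanSpace ℝ (Fin n))
    (j : Fin p) : ℝ :=
  ⟪xcol X j, v⟫ / n

theorem fit_eq_sum (X : Matrix (Fin n) (Fin p) ℝ) (b : Fin p → ℝ) :
    fit X b = ∑ j, b j • xcol X j := by
  ext i
  simp [fit, xcol, mulVec, dotProduct, mul_comm]

theorem inner_xcol (X : Matrix (Fin n) (Fin p) ℝ) (j : Fin p) (v : EuclideanSpace ℝ (Fin n)) :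
    ⟪xcol X j, v⟫ = (Xᵀ *ᵥ v.ofLp) j := by
  simp [xcol, PiLp.inner_apply, mulVec, dotProduct, mul_comm]

theorem corr_sub (X : Matrix (Fin n) (Fin p) ℝ) (v v' : EuclideanSpace ℝ (Fin n)) (j : Fin p) :
    corr X (v - v') j = corr X v j - corr X v' j := by
  simp [corr, inner_sub_right, sub_div]

theorem inner_fit_of_support {X : Matrix (Fin n) (Fin p) ℝ} {A : Finset (Fin p)} {b : Fin p → ℝ}
    (hb : ∀ j ∉ A, b j = 0) (v : EuclideanSpace ℝ (Fin n)) :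
    ⟪fit X b, v⟫ = ∑ j ∈ A, b j * ⟪xcol X j, v⟫ := by
  rw [fit_eq_sum, sum_inner]
  simp_rw [real_inner_smul_left]
  refine (Finset.sum_subset (Finset.subset_univ A) fun j _ hj => ?_).symm
  simp [hb j hj]

theorem gram_apply (X : Matrix (Fin n) (Fin p) ℝ) (j k : Fin p) :
    gram X j k = ⟪xcol X j, xcol X k⟫ / n := by
  rw [inner_xcol]
  simp [gram, xcol, mul_apply, mulVec, dotProduct, div_eq_inv_mul]

/-- Restriction of a coefficient vector to the coordinates in `A`. -/
noncomputable def restr (A : Finset (Fin p)) (b : Fin p → ℝ) : EuclideanSpace ℝ A :=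
  WithLp.toLp 2 fun j => b j

theorem subGram_restr {X : Matrix (Fin n) (Fin p) ℝ} {A : Finset (Fin p)} {b : Fin p → ℝ}
    (hb : ∀ j ∉ A, b j = 0) (j : A) :
    Matrix.toEuclideanLin (subGram X A) (restr A b) j = corr X (fit X b) j := by
  rw [corr, real_inner_comm, inner_fit_of_support hb, Finset.sum_div, ← Finset.sum_coe_sort A]
  simp only [toLpLin_apply, mulVec, dotProduct, subGram, submatrix_apply,
    gram_apply, restr]
  refine Finset.sum_congr rfl fun k _ => ?_
  rw [real_inner_comm]; ring

theorem subGram_isHermitian (X : Matrix (Fin n) (Fin p) ℝ) (A : Finset (Fin p)) :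
    (subGram X A).IsHermitian := by
  ext j k
  simp [subGram, gram_apply, real_inner_comm]

theorem inner_subGram_restr {X : Matrix (Fin n) (Fin p) ℝ} {A : Finset (Fin p)} {b : Fin p → ℝ}
    (hb : ∀ j ∉ A, b j = 0) :
    ⟪Matrix.toEuclideanLin (subGram X A) (restr A b), restr A b⟫ = ‖fit X b‖ ^ 2 / n := by
  rw [PiLp.inner_apply, ← real_inner_self_eq_norm_sq, inner_fit_of_support hb, Finset.sum_div,
    ← Finset.sum_coe_sort A]
  refine Finset.sum_congr rfl fun k _ => ?_
  rw [subGram_restr hb]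
  simp [restr, corr]; ring

theorem exists_restr_eq {A : Finset (Fin p)} (v : EuclideanSpace ℝ A) :
    ∃ b : Fin p → ℝ, (∀ j ∉ A, b j = 0) ∧ restr A b = v := by
  classical
  refine ⟨fun j => if h : j ∈ A then v ⟨j, h⟩ else 0, fun j hj => by simp [hj], ?_⟩
  ext j
  simp [restr]

variable {X : Matrix (Fin n) (Fin p) ℝ} {dS : ℕ} {cL cU : ℝ}

/-- Gram matrices are positive semidefinite, so the lower bound on `‖Σ_A u‖` bounds the eigenvalues
themselves, and not only their absolute values, from below. -/
theorem SparseRiesz.eigenvalue_mem (h : SparseRiesz X dS cL cU) {A : Finset (Fin p)}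
    (hA : A.card ≤ dS) {x : ℝ}
    (hx : Module.End.HasEigenvalue (Matrix.toEuclideanLin (subGram X A)) x) :
    cL ≤ x ∧ x ≤ cU := by
  obtain ⟨h1, h2⟩ := h A hA
  obtain ⟨v, hv⟩ := hx.exists_hasEigenvector
  have hv0 : 0 < ‖v‖ := norm_pos_iff.2 hv.2
  have hTv : Matrix.toEuclideanLin (subGram X A) v = x • v := hv.apply_eq_smul
  have hx0 : 0 ≤ x := by
    obtain ⟨b, hb, rfl⟩ := exists_restr_eq v
    have := inner_subGram_restr (X := X) hb
    rw [hTv, real_inner_smul_left, real_inner_self_eq_norm_sq] at this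
    have h3 : 0 ≤ x * ‖restr A b‖ ^ 2 := by rw [this]; positivity
    exact nonneg_of_mul_nonneg_left h3 (by positivity)
  constructor
  · have := h1 (‖v‖⁻¹ • v) (by rw [norm_smul, norm_inv, norm_norm, inv_mul_cancel₀ hv0.ne'])
    rw [map_smul, hTv, norm_smul, norm_smul, norm_inv, norm_norm, Real.norm_of_nonneg hx0] at this
    calc cL ≤ ‖v‖⁻¹ * (x * ‖v‖) := this
      _ = x := by field_simp
  · refine h2 x ?_
    refine Module.End.hasEigenvalue_of_hasEigenvector (x := v.ofLp) ⟨?_, ?_⟩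
    · rw [Module.End.mem_eigenspace_iff]
      have := congrArg WithLp.ofLp hTv
      simpa using this
    · intro h0
      exact hv.2 (by ext i; simp [h0])

/-- Every quadratic form in `(w, c)` that is dominated on the spectral interval `[cL, cU]` is
dominated by the prediction norm; this turns the sparse Riesz condition into coordinatewise
estimates. -/
theorem SparseRiesz.sum_quadratic_le (h : SparseRiesz X dS cL cU) {A : Finset (Fin p)}
    (hA : A.card ≤ dS) {α μ δ : ℝ}
    (hq : ∀ x, cL ≤ x → x ≤ cU → ∀ r s : ℝ,
      α * (x * r) ^ 2 + 2 * μ * (x * r) * s + δ * s ^ 2 ≤ x * (r + s) ^ 2)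
    {w c : Fin p → ℝ} (hw : ∀ j ∉ A, w j = 0) (hc : ∀ j ∉ A, c j = 0) :
    ∑ j ∈ A, (α * corr X (fit X w) j ^ 2 + 2 * μ * corr X (fit X w) j * c j + δ * c j ^ 2)
      ≤ ‖fit X (w + c)‖ ^ 2 / n := by
  have hwc : ∀ j ∉ A, (w + c) j = 0 := fun j hj => by simp [hw j hj, hc j hj]
  have key := quadratic_le_of_spectrum
    (Matrix.isSymmetric_toEuclideanLin_iff.2 (subGram_isHermitian X A))
    (fun x hx => h.eigenvalue_mem hA hx) hq (restr A w) (restr A c)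
  have hadd : restr A w + restr A c = restr A (w + c) := by ext j; simp [restr]
  rw [hadd, inner_subGram_restr hwc, ← real_inner_self_eq_norm_sq,
    ← real_inner_self_eq_norm_sq, PiLp.inner_apply, PiLp.inner_apply, PiLp.inner_apply,
    Finset.mul_sum, Finset.mul_sum, Finset.mul_sum,
    ← Finset.sum_add_distrib, ← Finset.sum_add_distrib] at key
  refine le_trans (le_of_eq ?_) key
  rw [← Finset.sum_coe_sort A]
  refine Finset.sum_congr rfl fun k _ => ?_
  rw [subGram_restr hw]
  simp [restr]; ring

theorem SparseRiesz.le_norm_fit (h : SparseRiesz X dS cL cU) (hcL : 0 < cL) {A : Finset (Fin p)}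
    (hA : A.card ≤ dS) {c : Fin p → ℝ} (hc : ∀ j ∉ A, c j = 0) :
    cL * ∑ j ∈ A, c j ^ 2 ≤ ‖fit X c‖ ^ 2 / n := by
  have := h.sum_quadratic_le hA (α := 0) (μ := 1) (δ := cL) (w := 0) (c := c)
    (fun x h1 _ r s => ?_) (fun _ _ => rfl) hc
  · simpa [Finset.mul_sum, corr] using this
  · nlinarith [mul_nonneg (hcL.le.trans h1) (sq_nonneg r), mul_nonneg (sub_nonneg.2 h1)
      (sq_nonneg s)]

theorem SparseRiesz.eq_zero_of_fit (h : SparseRiesz X dS cL cU) (hcL : 0 < cL)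
    {A : Finset (Fin p)} (hA : A.card ≤ dS) {c : Fin p → ℝ} (hc : ∀ j ∉ A, c j = 0)
    (h0 : ‖fit X c‖ ^ 2 / n ≤ 0) : c = 0 := by
  have h1 := (h.le_norm_fit hcL hA hc).trans h0
  have h2 : ∑ j ∈ A, c j ^ 2 ≤ 0 := nonpos_of_mul_nonpos_right h1 hcL
  have h3 := (Finset.sum_eq_zero_iff_of_nonneg fun j _ => sq_nonneg (c j)).1
    (le_antisymm h2 (Finset.sum_nonneg fun j _ => sq_nonneg (c j)))
  ext j
  by_cases hj : j ∈ A
  · simpa using h3 j hj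
  · exact hc j hj

/-- Under the sparse Riesz condition the normal equations on a small set of columns are solvable
for every right-hand side. -/
theorem SparseRiesz.exists_corr_eq (h : SparseRiesz X dS cL cU) (hcL : 0 < cL)
    {A : Finset (Fin p)} (hA : A.card ≤ dS) (v : Fin p → ℝ) :
    ∃ b : Fin p → ℝ, (∀ j ∉ A, b j = 0) ∧ ∀ j ∈ A, corr X (fit X b) j = v j := by
  have hinj : Function.Injective (Matrix.toEuclideanLin (subGram X A)) := by
    refine (injective_iff_map_eq_zero _).2 fun u hu => ?_
    obtain ⟨b, hb, rfl⟩ := exists_restr_eq u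
    have h1 := inner_subGram_restr (X := X) hb
    rw [hu, inner_zero_left] at h1
    rw [h.eq_zero_of_fit hcL hA hb h1.symm.le]
    ext j; simp [restr]
  obtain ⟨u, hu⟩ := LinearMap.injective_iff_surjective.1 hinj (restr A v)
  obtain ⟨b, hb, rfl⟩ := exists_restr_eq u
  refine ⟨b, hb, fun j hj => ?_⟩
  rw [← subGram_restr hb ⟨j, hj⟩, hu]
  rfl

theorem SparseRiesz.linearIndependent (h : SparseRiesz X dS cL cU) (hcL : 0 < cL)
    {A : Finset (Fin p)} (hA : A.card ≤ dS) : LinearIndependent ℝ fun j : A => xcol X j := by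
  rw [Fintype.linearIndependent_iff]
  intro g hg
  obtain ⟨b, hb, hbg⟩ := exists_restr_eq (WithLp.toLp 2 g : EuclideanSpace ℝ A)
  have hgb : ∀ j : A, b j = g j := fun j => congrArg (fun v : EuclideanSpace ℝ A => v j) hbg
  have hfit : fit X b = 0 := by
    rw [fit_eq_sum, ← hg, ← Finset.sum_subset (Finset.subset_univ A), ← Finset.sum_coe_sort A]
    · exact Finset.sum_congr rfl fun j _ => by rw [hgb]
    · intro j _ hj; simp [hb j hj]
  intro j
  rw [← hgb, h.eq_zero_of_fit hcL hA hb (by simp [hfit])]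
  rfl

/-- The two-by-two form inequality behind the sparsity bound. The weight `e` tends to `3/4` as the
condition number `cU / cL` grows and equals `1/2` for condition number one. -/
theorem quadratic_bound_weight {cL cU x : ℝ} (hcL : 0 < cL) (hx : cL ≤ x) (hxU : x ≤ cU) (r s : ℝ) :
    ((3 / 4 - cL / (4 * cU)) / cU) * (x * r) ^ 2 + 2 * (1 / 2) * (x * r) * s
      + ((3 / 4 - cL / (4 * cU)) * cL) * s ^ 2 ≤ x * (r + s) ^ 2 := by
  have hcU : 0 < cU := hcL.trans_le (hx.trans hxU)
  have hx0 : 0 < x := hcL.trans_le hx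
  set u := cL / cU with hu
  have hu0 : 0 < u := div_pos hcL hcU
  have hu1 : u ≤ 1 := (div_le_one hcU).2 (hx.trans hxU)
  have hcLu : cL = u * cU := by rw [hu]; field_simp
  have he : 3 / 4 - cL / (4 * cU) = (3 - u) / 4 := by rw [hu]; field_simp
  set z := x / cU with hz
  have hxz : x = z * cU := by rw [hz]; field_simp
  have hz0 : 0 < z := div_pos hx0 hcU
  have hz1 : z ≤ 1 := (div_le_one hcU).2 hxU
  have huz : u ≤ z := by rw [hu, hz]; gcongr
  rw [he]
  have e1 : x * (r + s) ^ 2 - ((3 - u) / 4 / cU * (x * r) ^ 2 + 2 * (1 / 2) * (x * r) * s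
      + ((3 - u) / 4 * cL) * s ^ 2)
      = cU * (z * (1 - (3 - u) / 4 * z) * r ^ 2 + z * r * s + (z - (3 - u) / 4 * u) * s ^ 2) := by
    rw [hxz, hcLu]; field_simp; ring
  have hA : 0 < z * (1 - (3 - u) / 4 * z) := mul_pos hz0 (by nlinarith)
  -- the discriminant condition is concave in `z` after division by `z`, and holds at both ends
  have hdisc : z ^ 2 ≤ 4 * (z * (1 - (3 - u) / 4 * z)) * (z - (3 - u) / 4 * u) := by
    have e2 : 4 * (z * (1 - (3 - u) / 4 * z)) * (z - (3 - u) / 4 * u) - z ^ 2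
        = z * ((3 - u) * ((z - u) * (1 - z)) + z * (u * (1 - u) ^ 2 / 4)) := by ring
    have h3 : 0 ≤ (3 - u) * ((z - u) * (1 - z)) :=
      mul_nonneg (by linarith) (mul_nonneg (by linarith) (by linarith))
    have h5 : 0 ≤ z * ((3 - u) * ((z - u) * (1 - z)) + z * (u * (1 - u) ^ 2 / 4)) := by positivity
    linarith
  have : 0 ≤ z * (1 - (3 - u) / 4 * z) * r ^ 2 + z * r * s + (z - (3 - u) / 4 * u) * s ^ 2 := by
    have h4 : 0 ≤ 4 * (z * (1 - (3 - u) / 4 * z)) * (z * (1 - (3 - u) / 4 * z) * r ^ 2 + z * r * s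
        + (z - (3 - u) / 4 * u) * s ^ 2) := by
      have : 4 * (z * (1 - (3 - u) / 4 * z)) * (z * (1 - (3 - u) / 4 * z) * r ^ 2 + z * r * s
        + (z - (3 - u) / 4 * u) * s ^ 2) = (2 * (z * (1 - (3 - u) / 4 * z)) * r + z * s) ^ 2
          + (4 * (z * (1 - (3 - u) / 4 * z)) * (z - (3 - u) / 4 * u) - z ^ 2) * s ^ 2 := by ring
      rw [this]
      have := sub_nonneg.2 hdisc
      positivity
    exact nonneg_of_mul_nonneg_right h4 (by positivity)
  nlinarith [mul_nonneg hcU.le this]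

/-- The coordinatewise lower bound off the oracle support: a tight coordinate, i.e. one with
`|g| = (lam - |c| / γ)₊` and `g`, `c` of equal sign, contributes at least as much as an inactive
one. -/
theorem tight_coordinate_bound {α δ γ lam g c : ℝ} (hα : 0 ≤ α) (hγ : 0 < γ) (hαγ : α ≤ γ / 2)
    (hδγ : 1 ≤ δ * γ) (hlam : 0 ≤ lam) (hg : |g| = max (lam - |c| / γ) 0) (hgc : 0 ≤ g * c) :
    α * lam ^ 2 ≤ α * g ^ 2 + 2 * (1 / 2) * g * c + δ * c ^ 2 := by
  have hgc' : g * c = |g| * |c| := by rw [← abs_mul, abs_of_nonneg hgc]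
  have e : α * g ^ 2 + 2 * (1 / 2) * g * c + δ * c ^ 2
      = α * |g| ^ 2 + |g| * |c| + δ * |c| ^ 2 := by
    rw [sq_abs, sq_abs, ← hgc']; ring
  rw [e]
  generalize |g| = a at *
  have ht := abs_nonneg c
  set t := |c| / γ with htd
  have hc : |c| = t * γ := by rw [htd]; field_simp
  have ht0 : 0 ≤ t := by positivity
  rw [hc]
  have hδ : t ^ 2 * γ ≤ δ * (t * γ) ^ 2 := by
    have : t ^ 2 * γ * 1 ≤ t ^ 2 * γ * (δ * γ) := by gcongr
    nlinarith
  rcases le_total t lam with h | h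
  · rw [max_eq_left (by linarith)] at hg
    subst hg
    nlinarith [mul_nonneg (sub_nonneg.2 hαγ) (mul_nonneg ht0 hlam), mul_nonneg hα (sq_nonneg t)]
  · rw [max_eq_right (by linarith)] at hg
    subst hg
    nlinarith [mul_nonneg (sub_nonneg.2 hαγ) (sq_nonneg t),
        mul_nonneg hα (mul_nonneg hlam (sub_nonneg.2 h)),
            mul_nonneg hα (mul_nonneg ht0 (sub_nonneg.2 h)), mul_nonneg hγ.le (sq_nonneg t)]

/-- With `m` tight coordinates and `d` oracle coordinates, the lower bound for the prediction norm
exceeds the noise level; this is where `d * (cU / cL - 1 / 2) ≤ m` enters. -/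
theorem sparsity_arith {d m : ℕ} {cL cU lam : ℝ} (hcL : 0 < cL) (hcU : cL ≤ cU) (hlam : 0 < lam)
    (hm : 1 ≤ m) (hdm : (d : ℝ) * (cU / cL - 1 / 2) ≤ m) :
    (m : ℝ) * lam ^ 2 / (4 * cU) <
      m * ((3 / 4 - cL / (4 * cU)) / cU * lam ^ 2)
        - d * ((1 / (4 * ((3 / 4 - cL / (4 * cU)) * cL)) - (3 / 4 - cL / (4 * cU)) / cU)
          * lam ^ 2) := by
  have hcU0 : 0 < cU := hcL.trans_le hcU
  set u := cL / cU with hu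
  have hu0 : 0 < u := div_pos hcL hcU0
  have hu1 : u ≤ 1 := (div_le_one hcU0).2 hcU
  have hcLu : cL = u * cU := by rw [hu]; field_simp
  have he : 3 / 4 - cL / (4 * cU) = (3 - u) / 4 := by rw [hu]; field_simp
  have hk : cU / cL = 1 / u := by rw [hu]; field_simp
  rw [hk] at hdm
  rw [he, hcLu]
  have hm1 : (1 : ℝ) ≤ m := by exact_mod_cast hm
  have hd0 : (0 : ℝ) ≤ d := by positivity
  have h3u : 0 < 3 - u := by linarith
  have hdm' : (d : ℝ) * (1 - u / 2) ≤ m * u := by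
    have := mul_le_mul_of_nonneg_right hdm hu0.le
    calc (d : ℝ) * (1 - u / 2) = d * (1 / u - 1 / 2) * u := by field_simp
      _ ≤ m * u := this
  have e : (m : ℝ) * ((3 - u) / 4 / cU * lam ^ 2)
        - d * ((1 / (4 * ((3 - u) / 4 * (u * cU))) - (3 - u) / 4 / cU) * lam ^ 2)
        - m * lam ^ 2 / (4 * cU)
      = lam ^ 2 / (cU * u * (3 - u)) *
        (m * u * (2 - u) * (3 - u) / 4 - d * (1 - u * (3 - u) ^ 2 / 4)) := by
    field_simp
    ring
  suffices h : 0 < (m : ℝ) * u * (2 - u) * (3 - u) / 4 - d * (1 - u * (3 - u) ^ 2 / 4) by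
    have : 0 < lam ^ 2 / (cU * u * (3 - u)) := by positivity
    have := mul_pos this h
    linarith
  have hc : 0 < (2 - u) * (3 - u) / 4 := by nlinarith
  -- the polynomial inequality that fixes the constant `cU / cL - 1 / 2`
  have hpoly : 0 < (1 - u / 2) * ((2 - u) * (3 - u) / 4) - (1 - u * (3 - u) ^ 2 / 4) := by
    nlinarith [mul_nonneg hu0.le (sub_nonneg.2 hu1), mul_nonneg (mul_nonneg hu0.le hu0.le)
        (sub_nonneg.2 hu1)]
  have hmu : 0 < (m : ℝ) * u := by positivity
  have h1 := mul_le_mul_of_nonneg_right hdm' hc.le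
  rcases hd0.eq_or_lt with h0 | h0
  · rw [← h0]; nlinarith
  · have := mul_pos h0 hpoly
    nlinarith

/-- The sparsity bound: if the noise is small relative to `lam` on the span of the columns in `A`,
orthogonally to those in `B`, then no critical point at level `lam` is supported in `A` with all
coordinates of `A \ B` tight. -/
theorem SparseRiesz.not_all_tight (h : SparseRiesz X dS cL cU) (hcL : 0 < cL) (hcU : cL ≤ cU)
    {A B : Finset (Fin p)} (hBA : B ⊆ A) (hA : A.card = dS) {m : ℕ} (hm : 1 ≤ m)
    (hAB : (A \ B).card = m) (hdm : (B.card : ℝ) * (cU / cL - 1 / 2) ≤ m)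
    {γ lam : ℝ} (hγ : 2 ≤ cL * γ) (hlam : 0 < lam) {y : EuclideanSpace ℝ (Fin n)}
    {b bo : Fin p → ℝ} (hb : ∀ j ∉ A, b j = 0) (hbo : ∀ j ∉ B, bo j = 0)
    (hB : ∀ j ∈ B, |corr X (y - fit X b) j| ≤ lam)
    (htight : ∀ j ∈ A \ B, |corr X (y - fit X b) j| = max (lam - |b j| / γ) 0 ∧
      0 ≤ corr X (y - fit X b) j * b j)
    (hnoise : ∀ e : Fin p → ℝ, (∀ j ∉ A, e j = 0) →
      (∀ j ∈ A, corr X (y - fit X bo - fit X e) j = 0) →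
        ‖fit X e‖ ^ 2 / n ≤ m * lam ^ 2 / (4 * cU)) : False := by
  have hcU0 : 0 < cU := hcL.trans_le hcU
  have hγ0 : 0 < γ := by
    by_contra h0
    nlinarith
  obtain ⟨bb, hbb, hbb'⟩ := h.exists_corr_eq hcL hA.le (corr X y)
  have hboA : ∀ j ∉ A, bo j = 0 := fun j hj => hbo j fun hj' => hj (hBA hj')
  have hw : ∀ j ∉ A, (bb - b) j = 0 := fun j hj => by simp [hbb j hj, hb j hj]
  have hc : ∀ j ∉ A, (b - bo) j = 0 := fun j hj => by simp [hboA j hj, hb j hj]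
  set e := 3 / 4 - cL / (4 * cU) with he
  have he2 : 1 / 2 ≤ e := by
    have : cL / (4 * cU) ≤ 1 / 4 := by rw [div_le_iff₀ (by positivity)]; linarith
    linarith
  have he1 : e ≤ 3 / 4 := by
    have : 0 ≤ cL / (4 * cU) := by positivity
    linarith
  have key := h.sum_quadratic_le hA.le (fun x h1 h2 r s =>
      quadratic_bound_weight hcL h1 h2 r s) hw hc
  rw [show bb - b + (b - bo) = bb - bo by abel] at key
  have hnz := hnoise (bb - bo) (fun j hj => by simp [hbb j hj, hboA j hj]) fun j hj => by
    rw [map_sub, corr_sub, corr_sub, corr_sub, hbb' j hj]; ring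
  have hg : ∀ j ∈ A, corr X (fit X (bb - b)) j = corr X (y - fit X b) j := by
    intro j hj
    rw [map_sub, corr_sub, corr_sub, hbb' j hj]
  have hlow := sparsity_arith hcL hcU hlam hm hdm
  rw [← he] at hlow key
  have hsum : (m : ℝ) * (e / cU * lam ^ 2) - B.card * ((1 / (4 * (e * cL)) - e / cU) * lam ^ 2)
      ≤ ∑ j ∈ A, (e / cU * corr X (fit X (bb - b)) j ^ 2
        + 2 * (1 / 2) * corr X (fit X (bb - b)) j * (b - bo) j + e * cL * (b - bo) j ^ 2) := by
    rw [← Finset.sum_sdiff hBA]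
    have h1 : (m : ℝ) * (e / cU * lam ^ 2) ≤ ∑ j ∈ A \ B, (e / cU * corr X (fit X (bb - b)) j ^ 2
        + 2 * (1 / 2) * corr X (fit X (bb - b)) j * (b - bo) j + e * cL * (b - bo) j ^ 2) := by
      rw [← hAB, ← nsmul_eq_mul]
      refine Finset.card_nsmul_le_sum _ _ _ fun j hj => ?_
      have hj' := Finset.mem_sdiff.1 hj
      rw [hg j hj'.1, Pi.sub_apply, hbo j hj'.2, sub_zero]
      refine tight_coordinate_bound (by positivity) hγ0 ?_ ?_ hlam.le (htight j hj).1 (htight j hj).2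
      · rw [div_le_iff₀ hcU0]; nlinarith
      · nlinarith
    have h2 : -(B.card * ((1 / (4 * (e * cL)) - e / cU) * lam ^ 2))
        ≤ ∑ j ∈ B, (e / cU * corr X (fit X (bb - b)) j ^ 2
        + 2 * (1 / 2) * corr X (fit X (bb - b)) j * (b - bo) j + e * cL * (b - bo) j ^ 2) := by
      rw [← mul_neg, ← nsmul_eq_mul]
      refine Finset.card_nsmul_le_sum _ _ _ fun j hj => ?_
      rw [hg j (hBA hj)]
      have hgl := sq_le_sq' (neg_le_of_abs_le (hB j hj)) (le_of_abs_le (hB j hj))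
      generalize corr X (y - fit X b) j = g at hgl
      generalize (b - bo) j = c
      have hK : 0 ≤ 1 / (4 * (e * cL)) - e / cU := by
        have h4 : 4 * e ^ 2 * cL ≤ cU := by
          have hu0 : 0 ≤ cL / cU := by positivity
          have hu1 : cL / cU ≤ 1 := (div_le_one hcU0).2 hcU
          have hcLu : cL = cL / cU * cU := by field_simp
          have heu : e = (3 - cL / cU) / 4 := by rw [he]; field_simp
          generalize cL / cU = u at *
          have : cU - 4 * e ^ 2 * cL = cU * ((1 - u) ^ 2 * (4 - u) / 4) := by
            rw [heu, hcLu]; ring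
          have h0 : 0 ≤ cU * ((1 - u) ^ 2 * (4 - u) / 4) := by
            have : 0 ≤ 4 - u := by linarith
            positivity
          linarith
        rw [sub_nonneg, div_le_div_iff₀ hcU0 (by positivity)]
        nlinarith
      have hsq : 0 ≤ e * cL * (c + g / (2 * (e * cL))) ^ 2 := by positivity
      have e3 : e / cU * g ^ 2 + 2 * (1 / 2) * g * c + e * cL * c ^ 2
          = e * cL * (c + g / (2 * (e * cL))) ^ 2 - (1 / (4 * (e * cL)) - e / cU) * g ^ 2 := by
        field_simp
        ring
      rw [e3]
      nlinarith [mul_le_mul_of_nonneg_left hgl hK]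
    linarith
  linarith

end Geometry

/-! ### Following the main branch -/

section MainBranch

variable {n p : ℕ} {X : Matrix (Fin n) (Fin p) ℝ} {γ lam : ℝ} {y : Fin n → ℝ} {b : Fin p → ℝ}

theorem corr_residual (j : Fin p) :
    corr X (WithLp.toLp 2 y - fit X b) j = (Xᵀ *ᵥ (y - X *ᵥ b)) j / n := by
  rw [corr, inner_xcol]; rfl

theorem mcpDeriv_eq (hlam : 0 < lam) (t : ℝ) :
    mcpDeriv γ lam t = max (lam - t / γ) 0 := by
  rw [mcpDeriv, mul_max_of_nonneg _ _ hlam.le, mul_zero]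
  congr 1
  field_simp

/-- Active coordinates of a critical point are tight, and the score has
the sign of the coefficient. -/
theorem IsCriticalPoint.tight_of_ne_zero (h : IsCriticalPoint γ X y lam b) (hlam : 0 < lam)
    {j : Fin p} (hj : b j ≠ 0) :
    |corr X (WithLp.toLp 2 y - fit X b) j| = max (lam - |b j| / γ) 0 ∧
      0 ≤ corr X (WithLp.toLp 2 y - fit X b) j * b j := by
  have h1 := (h.2 j).1 hj
  rw [corr_residual, h1, mcpDeriv_eq hlam]
  have h0 : 0 ≤ max (lam - |b j| / γ) 0 := le_max_right _ _
  rcases lt_or_gt_of_ne hj with hb | hb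
  · rw [Real.sign_of_neg hb]
    exact ⟨by rw [neg_one_mul, abs_neg, abs_of_nonneg h0], by nlinarith⟩
  · rw [Real.sign_of_pos hb, one_mul]
    exact ⟨abs_of_nonneg h0, by positivity⟩

theorem IsCriticalPoint.abs_corr_le (h : IsCriticalPoint γ X y lam b) (hγ : 0 < γ) (hlam : 0 < lam)
    (j : Fin p) : |corr X (WithLp.toLp 2 y - fit X b) j| ≤ lam := by
  by_cases hj : b j = 0
  · rw [corr_residual]; exact (h.2 j).2 hj
  · rw [(h.tight_of_ne_zero hlam hj).1]
    refine max_le ?_ hlam.le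
    have : 0 ≤ |b j| / γ := by positivity
    linarith

/-- Replacing an oracle coefficient beyond the flat point `γ lam` by a critical one changes the
score by at most the maximal concavity `1 / γ` of the penalty. -/
theorem concavity_of_large {γ lam g c o : ℝ} (hγ : 0 < γ) (ho : γ * lam ≤ |o|) (hgl : |g| ≤ lam)
    (hg : c ≠ 0 → |g| = max (lam - |c| / γ) 0 ∧ 0 ≤ g * c) :
    (c - o) * (0 - g) ≤ (c - o) ^ 2 / γ := by
  -- by symmetry the oracle coefficient may be taken positive
  suffices key : ∀ g c o : ℝ, 0 ≤ o → γ * lam ≤ o → |g| ≤ lam →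
      (c ≠ 0 → |g| = max (lam - |c| / γ) 0 ∧ 0 ≤ g * c) → (c - o) * (0 - g) ≤ (c - o) ^ 2 / γ by
    rcases le_total 0 o with h | h
    · exact key g c o h (by rwa [abs_of_nonneg h] at ho) hgl hg
    · have := key (-g) (-c) (-o) (by linarith) (by rwa [abs_of_nonpos h] at ho) (by rwa [abs_neg])
        (fun hc => by
          have := hg (by simpa using hc)
          rw [abs_neg, abs_neg]
          exact ⟨this.1, by linarith [this.2]⟩)
      calc (c - o) * (0 - g) = (-c - -o) * (0 - -g) := by ring
        _ ≤ _ := this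
        _ = _ := by ring
  clear hg hgl ho g c o
  intro g c o ho0 ho hgl hg
  rw [le_div_iff₀ hγ]
  have hg2 := abs_le.1 hgl
  by_cases hc : c = 0
  · subst hc
    nlinarith [mul_le_mul_of_nonneg_left ho ho0, mul_nonneg (mul_nonneg ho0 hγ.le)
        (sub_nonneg.2 hg2.2)]
  obtain ⟨h1, h2⟩ := hg hc
  rcases lt_or_gt_of_ne hc with h | h
  · have : g ≤ 0 := by by_contra h3; push Not at h3; nlinarith [mul_pos h3 (neg_pos.2 h)]
    nlinarith [mul_nonneg (mul_nonneg (neg_nonneg.2 this) (by linarith : 0 ≤ o - c)) hγ.le,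
        sq_nonneg (c - o)]
  · have hg0 : 0 ≤ g := by by_contra h3; push Not at h3; nlinarith [mul_pos (neg_pos.2 h3) h]
    rw [abs_of_nonneg hg0, abs_of_pos h] at h1
    rcases le_total (lam - c / γ) 0 with h4 | h4
    · rw [max_eq_right h4] at h1
      subst h1; nlinarith [sq_nonneg (c - o)]
    · rw [max_eq_left h4] at h1
      have h5 : γ * g = γ * lam - c := by rw [h1]; field_simp
      have h6 : 0 ≤ γ * g := by positivity
      nlinarith

/-- The analogue of `concavity_of_large` outside the oracle support, where the oracle coefficient
is zero. -/
theorem concavity_of_zero {γ lam g c go : ℝ} (hgo : |go| ≤ lam)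
    (hg : c ≠ 0 → |g| = max (lam - |c| / γ) 0 ∧ 0 ≤ g * c) :
    c * (go - g) ≤ c ^ 2 / γ := by
  by_cases hc : c = 0
  · subst hc; simp
  obtain ⟨h1, h2⟩ := hg hc
  have h3 : g * c = |g| * |c| := by rw [← abs_mul, abs_of_nonneg h2]
  have h4 : c * go ≤ |c| * lam := by
    calc c * go ≤ |c * go| := le_abs_self _
      _ = |c| * |go| := abs_mul _ _
      _ ≤ _ := by gcongr
  have h5 : |c| * (lam - |c| / γ) ≤ |c| * |g| := by
    rw [h1]; gcongr; exact le_max_left _ _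
  have h6 : |c| * (|c| / γ) = c ^ 2 / γ := by rw [← sq_abs c]; ring
  nlinarith

/-- Sparse critical points are unique: on few columns the loss is more convex than the penalty is
concave, so a sparse critical point at a level at which the oracle is critical is the oracle. -/
theorem SparseRiesz.eq_oracle_of_critical {dS : ℕ} {cL cU : ℝ} (h : SparseRiesz X dS cL cU)
    (hcL : 0 < cL) (hγ : 2 ≤ cL * γ) {A B : Finset (Fin p)} (hBA : B ⊆ A) (hA : A.card ≤ dS)
    {bo : Fin p → ℝ} (hbo : ∀ j ∉ B, bo j = 0)
    (hbo' : ∀ j ∈ B, corr X (WithLp.toLp 2 y - fit X bo) j = 0)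
    (hoff : ∀ j ∉ B, |corr X (WithLp.toLp 2 y - fit X bo) j| ≤ lam)
    (hon : ∀ j ∈ B, γ * lam ≤ |bo j|) (hlam : 0 < lam)
    (hcrit : IsCriticalPoint γ X y lam b) (hb : ∀ j ∉ A, b j = 0) : b = bo := by
  have hγ0 : 0 < γ := by
    by_contra h0
    nlinarith
  have hd : ∀ j ∉ A, (b - bo) j = 0 := fun j hj => by
    simp [hb j hj, hbo j fun hj' => hj (hBA hj')]
  have h1 := h.le_norm_fit hcL hA hd
  have h2 : ‖fit X (b - bo)‖ ^ 2 / n = ∑ j ∈ A, (b - bo) j *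
      (corr X (WithLp.toLp 2 y - fit X bo) j - corr X (WithLp.toLp 2 y - fit X b) j) := by
    rw [← real_inner_self_eq_norm_sq, inner_fit_of_support hd, Finset.sum_div]
    refine Finset.sum_congr rfl fun j _ => ?_
    rw [mul_div_assoc]
    congr 1
    change corr X _ j = _
    rw [map_sub, corr_sub, corr_sub, corr_sub]; ring
  have h3 : ‖fit X (b - bo)‖ ^ 2 / n ≤ ∑ j ∈ A, (b - bo) j ^ 2 / γ := by
    rw [h2]
    refine Finset.sum_le_sum fun j _ => ?_
    by_cases hjB : j ∈ B
    · rw [hbo' j hjB]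
      exact concavity_of_large hγ0 (hon j hjB) (hcrit.abs_corr_le hγ0 hlam j)
        fun hc => hcrit.tight_of_ne_zero hlam hc
    · rw [Pi.sub_apply, hbo j hjB, sub_zero]
      exact concavity_of_zero (hoff j hjB) fun hc => hcrit.tight_of_ne_zero hlam hc
  rw [← Finset.sum_div] at h3
  set Q := ∑ j ∈ A, (b - bo) j ^ 2 with hQ
  have hQ0 : 0 ≤ Q := Finset.sum_nonneg fun j _ => sq_nonneg _
  have h4 : Q / γ ≤ cL * Q / 2 := by
    rw [div_le_iff₀ hγ0]; nlinarith
  have h5 : ‖fit X (b - bo)‖ ^ 2 / n ≤ 0 := by nlinarith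
  exact sub_eq_zero.1 (h.eq_zero_of_fit hcL hA hd h5)

/-- The MC+ selector at a level of the good range is the oracle. The set of path parameters at
which fewer than `dS - #B` coordinates outside `B` are active is closed because the active set can
only shrink in a limit, and open because the tight coordinates, which contain all active ones
nearby, are equally few: above `lam2` by `SparseRiesz.not_all_tight`, below `lam2` because the
critical point is the oracle. -/
theorem SparseRiesz.mcPlus_eq_oracle {dS : ℕ} {cL cU : ℝ} (h : SparseRiesz X dS cL cU)
    (hcL : 0 < cL) (hcU : cL ≤ cU) (hγ : 2 ≤ cL * γ) {B : Finset (Fin p)} (hBd : B.card < dS)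
    (hdm : (B.card : ℝ) * (cU / cL - 1 / 2) ≤ (dS - B.card : ℕ))
    {bo : Fin p → ℝ} (hbo : ∀ j ∉ B, bo j = 0)
    (hbo' : ∀ j ∈ B, corr X (WithLp.toLp 2 y - fit X bo) j = 0) {lam1 lam2 : ℝ}
    (hoff : ∀ j ∉ B, |corr X (WithLp.toLp 2 y - fit X bo) j| < lam1)
    (hon : ∀ j ∈ B, γ * lam2 ≤ |bo j|)
    (hnoise : ∀ A, B ⊆ A → A.card = dS → ∀ e : Fin p → ℝ, (∀ j ∉ A, e j = 0) →
      (∀ j ∈ A, corr X (WithLp.toLp 2 y - fit X bo - fit X e) j = 0) →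
        ‖fit X e‖ ^ 2 / n ≤ (dS - B.card : ℕ) * lam2 ^ 2 / (4 * cU))
    (hlam : 0 < lam) (hlam1 : lam1 ≤ lam) (hlam2 : lam ≤ lam2)
    (hb : IsMCPlus γ X y lam b) : b = bo := by
  have hγ0 : 0 < γ := by
    by_contra h0
    nlinarith
  have hcU0 : 0 < cU := hcL.trans_le hcU
  obtain ⟨lamP, bP, hbr, rfl⟩ := hb
  set m := dS - B.card with hm
  have hm1 : 1 ≤ m := by omega
  set N : (Fin p → ℝ) → Finset (Fin p) := fun c => Finset.univ.filter fun j => j ∉ B ∧ c j ≠ 0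
    with hN
  -- sparse critical points in the good range are the oracle
  have huniq : ∀ t c, IsCriticalPoint γ X y t c → (N c).card < m → lam ≤ t → t ≤ lam2 →
      c = bo := by
    intro t c hc hNc ht1 ht2
    refine h.eq_oracle_of_critical hcL hγ (A := B ∪ N c) Finset.subset_union_left ?_ hbo hbo'
      (fun j hj => (hoff j hj).le.trans (hlam1.trans ht1))
      (fun j hj => (mul_le_mul_of_nonneg_left ht2 hγ0.le).trans (hon j hj))
      (hlam.trans_le ht1) hc ?_
    · exact (Finset.card_union_le _ _).trans (by omega)
    · intro j hj
      simp only [hN, Finset.mem_union, Finset.mem_filter, Finset.mem_univ, true_and, not_or,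
        not_and, not_not] at hj
      exact hj.2 hj.1
  -- along the path, sparsity extends from the active to the tight coordinates
  set Tt : ℝ → (Fin p → ℝ) → Finset (Fin p) := fun t c => Finset.univ.filter fun j =>
    j ∉ B ∧ t ≤ |corr X (WithLp.toLp 2 y - fit X c) j| + |c j| / γ with hTt
  have hNT : ∀ t c, 0 < t → IsCriticalPoint γ X y t c → N c ⊆ Tt t c := by
    intro t c ht hc j hj
    simp only [hN, hTt, Finset.mem_filter, Finset.mem_univ, true_and] at hj ⊢
    refine ⟨hj.1, ?_⟩
    rw [(hc.tight_of_ne_zero ht hj.2).1]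
    have := le_max_left (t - |c j| / γ) 0
    linarith
  have htight : ∀ t c, lam ≤ t → IsCriticalPoint γ X y t c → (N c).card < m →
      (Tt t c).card < m := by
    intro t c ht hc hNc
    have ht0 := hlam.trans_le ht
    rcases le_or_gt t lam2 with ht2 | ht2
    · have hcb := huniq t c hc hNc ht ht2
      subst hcb
      have : Tt t c = ∅ := by
        refine Finset.filter_eq_empty_iff.2 fun j _ hj => ?_
        have := hoff j hj.1
        rw [hbo j hj.1, abs_zero, zero_div, add_zero] at hj
        linarith [hj.2]
      rw [this, Finset.card_empty]; omega
    · by_contra hge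
      push Not at hge
      obtain ⟨S, hNS, hST, hS⟩ := Finset.exists_subsuperset_card_eq (hNT t c ht0 hc) hNc.le hge
      have hSB : Disjoint B S := by
        refine Finset.disjoint_left.2 fun j hjB hjS => ?_
        have := hST hjS
        simp only [hTt, Finset.mem_filter] at this
        exact this.2.1 hjB
      have hcard : (B ∪ S).card = dS := by
        rw [Finset.card_union_of_disjoint hSB]; omega
      have hsd : (B ∪ S) \ B = S := by
        rw [Finset.union_sdiff_left, Finset.sdiff_eq_self_of_disjoint hSB.symm]
      refine h.not_all_tight hcL hcU (A := B ∪ S) (B := B) Finset.subset_union_left hcard hm1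
        (by rw [hsd, hS]) hdm hγ ht0 (b := c) ?_ hbo
        (fun j _ => hc.abs_corr_le hγ0 ht0 j) ?_ ?_
      · intro j hj
        rw [Finset.mem_union, not_or] at hj
        by_contra hj0
        exact hj.2 (hNS (by simp [hN, hj.1, hj0]))
      · rw [hsd]
        intro j hj
        by_cases hj0 : c j = 0
        · have := hST hj
          simp only [hTt, Finset.mem_filter, hj0, abs_zero, zero_div, add_zero] at this
          rw [hj0, abs_zero, zero_div, sub_zero, max_eq_left ht0.le, mul_zero]
          exact ⟨le_antisymm (hc.abs_corr_le hγ0 ht0 j) this.2.2, le_rfl⟩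
        · exact hc.tight_of_ne_zero ht0 hj0
      · intro e he he'
        refine (hnoise _ Finset.subset_union_left hcard e he he').trans ?_
        have : 0 ≤ lam2 := hlam.le.trans hlam2
        gcongr
  -- the first hitting time
  have hN0 : (N 0).card < m := by
    have : N 0 = ∅ := Finset.filter_eq_empty_iff.2 fun j _ hj => hj.2 rfl
    rw [this, Finset.card_empty]; omega
  set H := {x : ℝ | 0 ≤ x ∧ lamP x ≤ lam} with hH
  have hHne : H.Nonempty := by
    obtain ⟨x, hx⟩ := ((hbr.tendsto_lam.eventually (gt_mem_nhds hlam)).and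
      (eventually_ge_atTop 0)).exists
    exact ⟨x, hx.2, hx.1.le⟩
  have hHbdd : BddBelow H := ⟨0, fun x hx => hx.1⟩
  have hHcl : IsClosed H := by
    have := hbr.continuousOn_lam.preimage_isClosed_of_isClosed isClosed_Ici
      (isClosed_Iic (a := lam))
    exact this
  set xl := firstHit lamP lam with hxl
  have hxlH : xl ∈ H := hHcl.csInf_mem hHne hHbdd
  have hbefore : ∀ x, 0 ≤ x → x < xl → lam < lamP x := by
    intro x hx0 hx
    by_contra hle
    exact absurd (csInf_le hHbdd (show x ∈ H from ⟨hx0, not_lt.1 hle⟩)) (not_le.2 hx)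
  rcases le_or_gt (lamP 0) lam with h0 | h0
  · -- the path starts below the level, and `0` is still critical at `lam`
    have hxl0 : xl = 0 := le_antisymm (csInf_le hHbdd ⟨le_rfl, h0⟩) hxlH.1
    rw [hxl0, hbr.start]
    refine huniq lam 0 ⟨hlam.le, fun j => ⟨fun hj => absurd rfl hj, fun _ => ?_⟩⟩ hN0 le_rfl hlam2
    have := ((hbr.critical 0 le_rfl).2 j).2 (by rw [hbr.start]; rfl)
    rw [hbr.start] at this
    exact this.trans h0
  have hxeq : lamP xl = lam := by
    have hcont : ContinuousOn lamP (Set.Icc 0 xl) :=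
      hbr.continuousOn_lam.mono fun x hx => hx.1
    obtain ⟨x, hx, hxe⟩ := intermediate_value_Icc' hxlH.1 hcont ⟨hxlH.2, h0.le⟩
    rcases hx.2.eq_or_lt with he | hlt
    · rwa [← he]
    · exact absurd hxe (hbefore x hx.1 hlt).ne'
  have hge : ∀ x ∈ Set.Icc 0 xl, lam ≤ lamP x := by
    intro x hx
    rcases hx.2.eq_or_lt with he | hlt
    · rw [he, hxeq]
    · exact (hbefore x hx.1 hlt).le
  have hbj : ∀ j, ContinuousOn (fun x => bP x j) (Set.Ici 0) := fun j =>
    (continuous_apply j).comp_continuousOn hbr.continuousOn_b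
  have hgj : ∀ j, ContinuousOn (fun x => corr X (WithLp.toLp 2 y - fit X (bP x)) j)
      (Set.Ici 0) := by
    intro j
    have : Continuous fun c : Fin p → ℝ => corr X (WithLp.toLp 2 y - fit X c) j := by
      have := (fit X).continuous_of_finiteDimensional
      unfold corr
      fun_prop
    exact this.comp_continuousOn hbr.continuousOn_b
  have hall : Set.Icc 0 xl ⊆ {x | (N (bP x)).card < m} := by
    refine IsClosed.Icc_subset_of_forall_mem_nhdsWithin ?_ ?_ ?_
    · refine isClosed_of_closure_subset fun x hx => ?_
      have hxI : x ∈ Set.Icc 0 xl :=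
        closure_minimal Set.inter_subset_right isClosed_Icc hx
      refine ⟨?_, hxI⟩
      -- active coordinates at `x` stay active nearby
      have hev : ∀ᶠ z in 𝓝[Set.Ici 0] x, ∀ j, bP x j ≠ 0 → bP z j ≠ 0 := by
        refine eventually_all.2 fun j => ?_
        by_cases hj : bP x j = 0
        · exact Eventually.of_forall fun z hz => absurd hj hz
        · filter_upwards [(hbj j x hxI.1).eventually_ne hj] with z hz _ using hz
      obtain ⟨z, hz1, hz2⟩ := ((mem_closure_iff_frequently.1 hx).and_eventually
        (eventually_nhdsWithin_iff.1 hev)).exists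
      refine lt_of_le_of_lt (Finset.card_le_card fun j hj => ?_) hz1.1
      simp only [hN, Finset.mem_filter, Finset.mem_univ, true_and] at hj ⊢
      exact ⟨hj.1, hz2 hz1.2.1 j hj.2⟩
    · simpa [hbr.start] using hN0
    · rintro x ⟨hxN, hx⟩
      have hxI : x ∈ Set.Icc 0 xl := ⟨hx.1, hx.2.le⟩
      have hT := htight _ _ (hge x hxI) (hbr.critical x hx.1) hxN
      -- coordinates that are not tight at `x` are inactive nearby
      have hev : ∀ᶠ z in 𝓝[Set.Ici 0] x, ∀ j, j ∉ B → j ∉ Tt (lamP x) (bP x) →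
          j ∉ Tt (lamP z) (bP z) := by
        refine eventually_all.2 fun j => ?_
        by_cases hj : j ∉ B ∧ j ∉ Tt (lamP x) (bP x)
        · have hlt : |corr X (WithLp.toLp 2 y - fit X (bP x)) j| + |bP x j| / γ < lamP x := by
            by_contra hle
            exact hj.2 (by simp [hTt, hj.1, not_lt.1 hle])
          have hc1 : ContinuousOn (fun z => |corr X (WithLp.toLp 2 y - fit X (bP z)) j|
              + |bP z j| / γ) (Set.Ici 0) := ((hgj j).abs).add ((hbj j).abs.div_const γ)
          filter_upwards [(hc1 x hx.1).eventually_lt (hbr.continuousOn_lam x hx.1) hlt] with z hz _ _ hmem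
          simp only [hTt, Finset.mem_filter] at hmem
          exact absurd hz (not_lt.2 hmem.2.2)
        · exact Eventually.of_forall fun z h1 h2 => absurd ⟨h1, h2⟩ hj
      have hsub : 𝓝[>] x ≤ 𝓝[Set.Ici 0] x :=
        nhdsWithin_mono x fun z hz => hx.1.trans (le_of_lt hz)
      have hlt : ∀ᶠ z in 𝓝[>] x, z < xl := (eventually_lt_nhds hx.2).filter_mono nhdsWithin_le_nhds
      filter_upwards [hsub hev, hlt, self_mem_nhdsWithin] with z hz hz1 hz2
      have hz0 : 0 ≤ z := hx.1.trans (le_of_lt hz2)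
      refine lt_of_le_of_lt (Finset.card_le_card fun j hj => ?_) hT
      have hjT := hNT _ _ (hlam.trans (hbefore z hz0 hz1)) (hbr.critical z hz0) hj
      have hjB : j ∉ B := by
        simp only [hN, Finset.mem_filter] at hj
        exact hj.2.1
      by_contra hnot
      exact hz j hjB hnot hjT
  have hfin := hall (Set.right_mem_Icc.2 hxlH.1)
  have hcr := hbr.critical xl hxlH.1
  rw [hxeq] at hcr
  exact huniq lam _ hcr hfin le_rfl hlam2

end MainBranch

/-! ### Gaussian and chi-square tails -/

section Tails

theorem setIntegral_Ioi_comp_add_right (f : ℝ → ℝ) (t : ℝ) :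
    ∫ x in Set.Ioi 0, f (x + t) = ∫ x in Set.Ioi t, f x := by
  rw [← (measurePreserving_add_right volume t).setIntegral_preimage_emb
    (measurableEmbedding_addRight t) f (Set.Ioi t)]
  simp

theorem gaussianReal_Ici_mean (t : ℝ) : gaussianReal t 1 (Set.Ici t) = ENNReal.ofReal (1 / 2) := by
  rw [gaussianReal_apply_eq_integral _ one_ne_zero, integral_Ici_eq_integral_Ioi]
  congr 1
  have h1 : ∀ x, gaussianPDFReal t 1 (x + t) =
      (√(2 * Real.pi))⁻¹ * Real.exp (-(1 / 2) * x ^ 2) := by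
    intro x
    simp only [gaussianPDFReal, NNReal.coe_one, mul_one]
    congr 2; ring
  rw [← setIntegral_Ioi_comp_add_right]
  simp_rw [h1]
  rw [integral_const_mul, integral_gaussian_Ioi]
  have h2 : Real.pi / (1 / 2) = 2 * Real.pi := by ring
  have h3 : √(2 * Real.pi) ≠ 0 := by positivity
  rw [h2]
  field_simp

/-- The Gaussian tail bound, with a prefactor that combines `1 / 2` for all thresholds with the
Mills ratio for large ones. -/
theorem gaussianReal_Ici_le {t : ℝ} (ht : 0 ≤ t) :
    gaussianReal 0 1 (Set.Ici t) ≤ ENNReal.ofReal (Real.exp (-(t ^ 2 / 2)) / max 2 t) := by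
  have hint : ∀ m : ℝ, IntegrableOn (gaussianPDFReal m 1) (Set.Ici t) := fun m =>
    (integrable_gaussianPDFReal m 1).integrableOn
  have hhalf : gaussianReal 0 1 (Set.Ici t) ≤ ENNReal.ofReal (Real.exp (-(t ^ 2 / 2)) / 2) := by
    rw [div_eq_mul_one_div, ENNReal.ofReal_mul (by positivity), ← gaussianReal_Ici_mean t,
      gaussianReal_apply_eq_integral _ one_ne_zero, gaussianReal_apply_eq_integral _ one_ne_zero,
      ← ENNReal.ofReal_mul (by positivity), ← integral_const_mul]
    refine ENNReal.ofReal_le_ofReal (setIntegral_mono_on (hint 0) ((hint t).const_mul _)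
      measurableSet_Ici fun x hx => ?_)
    have hx' : t ≤ x := hx
    simp only [gaussianPDFReal, NNReal.coe_one, mul_one]
    rw [mul_left_comm, ← Real.exp_add]
    gcongr
    nlinarith [mul_nonneg ht (sub_nonneg.2 hx')]
  rcases le_or_gt t 2 with h2 | h2
  · rwa [max_eq_left h2]
  rw [max_eq_right h2.le]
  have ht0 : 0 < t := by linarith
  rw [gaussianReal_apply_eq_integral _ one_ne_zero]
  have hexp : IntegrableOn (fun x => Real.exp (-t * x)) (Set.Ici t) := by
    rw [integrableOn_Ici_iff_integrableOn_Ioi]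
    exact integrableOn_exp_mul_Ioi (by linarith) t
  refine ENNReal.ofReal_le_ofReal ?_
  calc ∫ x in Set.Ici t, gaussianPDFReal 0 1 x
      ≤ ∫ x in Set.Ici t, Real.exp (t ^ 2 / 2) * Real.exp (-t * x) := by
        refine setIntegral_mono_on (hint 0) (hexp.const_mul _) measurableSet_Ici fun x hx => ?_
        simp only [gaussianPDFReal, NNReal.coe_one, mul_one]
        rw [← Real.exp_add]
        have h1 : (√(2 * Real.pi))⁻¹ ≤ 1 := by
          refine inv_le_one_of_one_le₀ (Real.one_le_sqrt.2 ?_)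
          nlinarith [Real.pi_gt_three]
        refine (mul_le_of_le_one_left (Real.exp_pos _).le h1).trans (Real.exp_le_exp.2 ?_)
        nlinarith [sq_nonneg (x - t)]
    _ = Real.exp (-(t ^ 2 / 2)) / t := by
        rw [integral_const_mul, integral_Ici_eq_integral_Ioi, integral_exp_mul_Ioi (by linarith)]
        rw [neg_div_neg_eq, mul_div_assoc', ← Real.exp_add]
        congr 2; ring

theorem exp_neg_le_quadratic {x : ℝ} (hx : 0 ≤ x) : Real.exp (-x) ≤ 1 - x + x ^ 2 / 2 := by
  have h := Real.quadratic_le_exp_of_nonneg hx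
  have h1 : 0 < 1 + x + x ^ 2 / 2 := by positivity
  rw [Real.exp_neg]
  refine (inv_anti₀ h1 h).trans ?_
  rw [inv_le_iff_one_le_mul₀ h1]
  nlinarith [sq_nonneg (x ^ 2)]

/-- The density of the logarithm of a rescaled chi-square variable, up to normalization: if `U` has
the Gamma distribution with shape `a`, then `log (U / a)` has density proportional to it. -/
noncomputable def logGammaDensity (a x : ℝ) : ℝ := Real.exp (a * (x - Real.exp x))

theorem continuous_logGammaDensity (a : ℝ) : Continuous (logGammaDensity a) := by
  unfold logGammaDensity; fun_prop

theorem integrable_logGammaDensity {a : ℝ} (ha : 0 < a) : Integrable (logGammaDensity a) := by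
  have h1 : IntegrableOn (logGammaDensity a) (Set.Iic 0) := by
    refine Integrable.mono' (integrableOn_exp_mul_Iic ha 0)
      (continuous_logGammaDensity a).aestronglyMeasurable (ae_of_all _ fun x => ?_)
    rw [logGammaDensity, Real.norm_of_nonneg (Real.exp_pos _).le]
    refine Real.exp_le_exp.2 ?_
    nlinarith [Real.exp_pos x]
  have h2 : IntegrableOn (logGammaDensity a) (Set.Ioi 0) := by
    refine Integrable.mono' ((integrable_exp_neg_mul_sq (half_pos ha)).integrableOn)
      (continuous_logGammaDensity a).aestronglyMeasurable ?_
    refine (ae_restrict_iff' measurableSet_Ioi).2 (ae_of_all _ fun x hx => ?_)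
    rw [logGammaDensity, Real.norm_of_nonneg (Real.exp_pos _).le]
    refine Real.exp_le_exp.2 ?_
    have := Real.quadratic_le_exp_of_nonneg (le_of_lt hx)
    nlinarith
  rw [← integrableOn_univ, ← Set.Iic_union_Ioi (a := (0 : ℝ))]
  exact h1.union h2

/-- Two lower bounds for the total mass of the log-gamma density, both from its left half: since
`x ≤ sinh x`, that half has at least the mass of the right one, and since
`exp (-x) ≤ 1 - x + x ^ 2 / 2`, at least that of a half Gaussian. -/
theorem integral_logGammaDensity_lower {a : ℝ} (ha : 0 < a) :
    2 * ∫ x in Set.Ioi 0, logGammaDensity a x ≤ ∫ x, logGammaDensity a x ∧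
      Real.exp (-a) * (√(Real.pi / (a / 2)) / 2) ≤ ∫ x, logGammaDensity a x := by
  have hint := integrable_logGammaDensity ha
  have hneg : IntegrableOn (fun x => logGammaDensity a (-x)) (Set.Ioi 0) :=
    (hint.comp_neg).integrableOn
  have hsplit : ∫ x, logGammaDensity a x
      = (∫ x in Set.Ioi 0, logGammaDensity a (-x)) + ∫ x in Set.Ioi 0, logGammaDensity a x := by
    rw [integral_comp_neg_Ioi, neg_zero, intervalIntegral.integral_Iic_add_Ioi hint.integrableOn
      hint.integrableOn]
  have hpos : 0 ≤ ∫ x in Set.Ioi 0, logGammaDensity a x :=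
    setIntegral_nonneg measurableSet_Ioi fun x _ => (Real.exp_pos _).le
  constructor
  · have : ∫ x in Set.Ioi 0, logGammaDensity a x ≤ ∫ x in Set.Ioi 0, logGammaDensity a (-x) := by
      refine setIntegral_mono_on hint.integrableOn hneg measurableSet_Ioi fun x hx => ?_
      refine Real.exp_le_exp.2 (mul_le_mul_of_nonneg_left ?_ ha.le)
      have := Real.self_le_sinh_iff.2 (le_of_lt hx)
      rw [Real.sinh_eq] at this
      linarith
    linarith
  · have : Real.exp (-a) * (√(Real.pi / (a / 2)) / 2)
        ≤ ∫ x in Set.Ioi 0, logGammaDensity a (-x) := by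
      rw [← integral_gaussian_Ioi, ← integral_const_mul]
      refine setIntegral_mono_on (((integrable_exp_neg_mul_sq (half_pos ha)).const_mul _).integrableOn)
        hneg measurableSet_Ioi fun x hx => ?_
      rw [← Real.exp_add]
      refine Real.exp_le_exp.2 ?_
      have := exp_neg_le_quadratic (le_of_lt hx)
      nlinarith
    linarith

/-- Chernoff-type tail bound for the log-gamma density, with the prefactor `1 / 2`, which improves
to order `1 / s` for large `s`. -/
theorem integral_logGammaDensity_tail {a s : ℝ} (ha : 1 / 2 ≤ a) (hs : 1 ≤ s) :
    ∫ x in Set.Ioi (Real.log s), logGammaDensity a x ≤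
      Real.exp (-(a * (s - 1 - Real.log s))) / max 2 ((s - 1) / 2) * ∫ x, logGammaDensity a x := by
  have ha0 : 0 < a := by linarith
  have hs0 : 0 < s := by linarith
  obtain ⟨h1, h2⟩ := integral_logGammaDensity_lower ha0
  have hint := integrable_logGammaDensity ha0
  set D := ∫ x, logGammaDensity a x with hD
  set L := Real.log s with hL
  have hshift : ∫ x in Set.Ioi L, logGammaDensity a x
      = ∫ x in Set.Ioi 0, logGammaDensity a (x + L) :=
    (setIntegral_Ioi_comp_add_right _ _).symm
  have hval : ∀ x, logGammaDensity a (x + L)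
      = Real.exp (a * (L - s)) * Real.exp (a * (x - s * (Real.exp x - 1))) := by
    intro x
    rw [logGammaDensity, Real.exp_add x L, hL, Real.exp_log hs0, ← Real.exp_add]
    congr 1; ring
  have hsint : IntegrableOn (fun x => logGammaDensity a (x + L)) (Set.Ioi 0) :=
    (hint.comp_add_right L).integrableOn
  rw [hshift]
  rcases le_or_gt ((s - 1) / 2) 2 with hs2 | hs2
  · rw [max_eq_left hs2]
    calc ∫ x in Set.Ioi 0, logGammaDensity a (x + L)
        ≤ ∫ x in Set.Ioi 0, Real.exp (-(a * (s - 1 - L))) * logGammaDensity a x := by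
          refine setIntegral_mono_on hsint (hint.integrableOn.const_mul _) measurableSet_Ioi
            fun x hx => ?_
          rw [hval, logGammaDensity, ← Real.exp_add, ← Real.exp_add]
          refine Real.exp_le_exp.2 ?_
          have h3 := Real.add_one_le_exp x
          have hx0 : 0 < x := hx
          have h4 : 0 ≤ a * ((s - 1) * (Real.exp x - 1)) :=
            mul_nonneg ha0.le (mul_nonneg (by linarith) (by linarith))
          nlinarith
      _ = Real.exp (-(a * (s - 1 - L))) * ∫ x in Set.Ioi 0, logGammaDensity a x :=
          integral_const_mul _ _
      _ ≤ Real.exp (-(a * (s - 1 - L))) * (D / 2) := by gcongr; linarith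
      _ = _ := by ring
  · rw [max_eq_right hs2.le]
    have hs1 : 0 < s - 1 := by linarith
    have hneg : -(a * (s - 1)) < 0 := by have := mul_pos ha0 hs1; linarith
    calc ∫ x in Set.Ioi 0, logGammaDensity a (x + L)
        ≤ ∫ x in Set.Ioi 0, Real.exp (a * (L - s)) * Real.exp (-(a * (s - 1)) * x) := by
          refine setIntegral_mono_on hsint ((integrableOn_exp_mul_Ioi hneg 0).const_mul _)
            measurableSet_Ioi fun x hx => ?_
          rw [hval]
          refine mul_le_mul_of_nonneg_left (Real.exp_le_exp.2 ?_) (Real.exp_pos _).le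
          have h3 := Real.add_one_le_exp x
          have h4 : 0 ≤ a * (s * (Real.exp x - 1 - x)) :=
            mul_nonneg ha0.le (mul_nonneg hs0.le (by linarith))
          nlinarith
      _ = Real.exp (-(a * (s - 1 - L))) * (Real.exp (-a) / (a * (s - 1))) := by
          rw [integral_const_mul, integral_exp_mul_Ioi hneg, mul_zero, Real.exp_zero,
              neg_div_neg_eq,
            mul_div_assoc', mul_div_assoc', ← Real.exp_add, mul_one]
          congr 2; ring
      _ ≤ Real.exp (-(a * (s - 1 - L))) * (2 * D / (s - 1)) := by
          refine mul_le_mul_of_nonneg_left ?_ (Real.exp_pos _).le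
          rw [← div_div]
          refine div_le_div_of_nonneg_right ?_ hs1.le
          have h5 : 1 / a ≤ √(Real.pi / (a / 2)) := by
            refine Real.le_sqrt_of_sq_le ?_
            rw [div_pow, div_le_div_iff₀ (by positivity) (by positivity)]
            nlinarith [Real.pi_gt_three, mul_pos ha0 ha0]
          calc Real.exp (-a) / a = Real.exp (-a) * (1 / a) := by ring
            _ ≤ Real.exp (-a) * √(Real.pi / (a / 2)) := by gcongr
            _ ≤ 2 * D := by linarith
      _ = _ := by field_simp

/-- The density of a vector of independent standard Gaussian variables. -/
theorem pi_gaussianReal_eq_withDensity (m : ℕ) :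
    Measure.pi (fun _ : Fin m => gaussianReal 0 1)
      = volume.withDensity fun x => ENNReal.ofReal (∏ i, gaussianPDFReal 0 1 (x i)) := by
  refine (Measure.pi_eq fun s hs => ?_)
  rw [withDensity_apply _ (MeasurableSet.univ_pi hs), volume_pi, Measure.restrict_pi_pi,
    ← ofReal_integral_eq_lintegral_ofReal, integral_fintype_prod_eq_prod,
        ENNReal.ofReal_prod_of_nonneg]
  · refine Finset.prod_congr rfl fun i _ => ?_
    rw [gaussianReal_apply_eq_integral _ one_ne_zero]
  · exact fun i _ => integral_nonneg fun x => gaussianPDFReal_nonneg _ _ _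
  · exact Integrable.fintype_prod fun i => (integrable_gaussianPDFReal 0 1).restrict
  · exact ae_of_all _ fun x => Finset.prod_nonneg fun i _ => gaussianPDFReal_nonneg _ _ _

/-- In polar and then logarithmic coordinates the radius of a standard Gaussian vector has the
log-gamma density; the normalizing constant is left implicit. -/
theorem exists_stdGaussian_norm_law {m : ℕ} (hm : 1 ≤ m) :
    ∃ K : ℝ, ∀ T : Set ℝ, MeasurableSet T →
      (stdGaussian (EuclideanSpace ℝ (Fin m))).real {z | ‖z‖ ∈ T}
        = K * ∫ x, {x | √m * Real.exp (x / 2) ∈ T}.indicator (logGammaDensity (m / 2)) x := by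
  have hm0 : (0 : ℝ) < m := by exact_mod_cast hm
  have hsm : 0 < √(m : ℝ) := Real.sqrt_pos.2 hm0
  have hden : ∀ x : Fin m → ℝ, ∏ i, gaussianPDFReal 0 1 (x i)
      = (√(2 * Real.pi))⁻¹ ^ m * Real.exp (-‖(WithLp.toLp 2 x : EuclideanSpace ℝ (Fin m))‖ ^ 2 / 2)
          := by
    intro x
    simp only [gaussianPDFReal, NNReal.coe_one, mul_one, sub_zero]
    rw [Finset.prod_mul_distrib, Finset.prod_const, Finset.card_univ, Fintype.card_fin,
      ← Real.exp_sum, EuclideanSpace.real_norm_sq_eq]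
    congr 2
    rw [← Finset.sum_div, Finset.sum_neg_distrib]
  set E := EuclideanSpace ℝ (Fin m)
  have : Nontrivial E := by
    have : Nonempty (Fin m) := ⟨⟨0, hm⟩⟩
    infer_instance
  have hdim : Module.finrank ℝ E = m := by simp [E]
  refine ⟨(√(2 * Real.pi))⁻¹ ^ m * (m * (volume.real (Metric.ball (0 : E) 1) *
    (√m ^ m / 2))), fun T hT => ?_⟩
  have hTm : MeasurableSet {z : E | ‖z‖ ∈ T} := measurable_norm hT
  have h1 : (stdGaussian E).real {z | ‖z‖ ∈ T}
      = ∫ z : E, (√(2 * Real.pi))⁻¹ ^ m * T.indicator (fun r => Real.exp (-r ^ 2 / 2)) ‖z‖ := by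
    have hlp : Measurable (WithLp.toLp 2 : (Fin m → ℝ) → E) := by fun_prop
    rw [← map_pi_eq_stdGaussian, map_measureReal_apply hlp hTm, measureReal_def,
      pi_gaussianReal_eq_withDensity, withDensity_apply _ (hlp hTm),
      ← ofReal_integral_eq_lintegral_ofReal]
    · rw [ENNReal.toReal_ofReal (integral_nonneg fun x =>
        Finset.prod_nonneg fun i _ => gaussianPDFReal_nonneg _ _ _),
        ← integral_indicator (hlp hTm)]
      rw [← (PiLp.volume_preserving_toLp (Fin m)).integral_comp
        (MeasurableEquiv.toLp 2 (Fin m → ℝ)).measurableEmbedding]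
      refine integral_congr_ae (ae_of_all _ fun x => ?_)
      have hiff : x ∈ WithLp.toLp 2 ⁻¹' {z : E | ‖z‖ ∈ T} ↔ ‖(WithLp.toLp 2 x : E)‖ ∈ T := Iff.rfl
      by_cases hx : ‖(WithLp.toLp 2 x : E)‖ ∈ T
      · simp only [Set.indicator_of_mem (hiff.2 hx), Set.indicator_of_mem hx, hden]
      · simp only [Set.indicator_of_notMem (hiff.not.2 hx), Set.indicator_of_notMem hx, mul_zero]
    · exact (Integrable.fintype_prod fun i => integrable_gaussianPDFReal 0 1).restrict
    · exact ae_of_all _ fun x => Finset.prod_nonneg fun i _ => gaussianPDFReal_nonneg _ _ _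
  rw [h1, integral_const_mul, integral_fun_norm_addHaar volume
    (T.indicator fun r => Real.exp (-r ^ 2 / 2)), hdim]
  have himg : (fun x : ℝ => √(m : ℝ) * Real.exp (x / 2)) '' Set.univ = Set.Ioi 0 := by
    ext r
    simp only [Set.image_univ, Set.mem_range, Set.mem_Ioi]
    constructor
    · rintro ⟨x, rfl⟩; positivity
    · intro hr
      refine ⟨2 * Real.log (r / √m), ?_⟩
      rw [mul_div_cancel_left₀ _ two_ne_zero, Real.exp_log (by positivity)]
      field_simp
  have hderiv : ∀ x ∈ (Set.univ : Set ℝ),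
      HasDerivWithinAt (fun x : ℝ => √(m : ℝ) * Real.exp (x / 2))
      (√(m : ℝ) * (Real.exp (x / 2) * (1 / 2))) Set.univ x := fun x _ =>
    ((((hasDerivAt_id x).div_const 2).exp).const_mul _).hasDerivWithinAt
  have hinj : Set.InjOn (fun x : ℝ => √(m : ℝ) * Real.exp (x / 2)) Set.univ := by
    intro x _ x' _ h
    have := Real.exp_injective (mul_left_cancel₀ hsm.ne' h)
    linarith
  rw [← himg, integral_image_eq_integral_abs_deriv_smul MeasurableSet.univ hderiv hinj,
    Measure.restrict_univ]
  have hfun : ∀ x : ℝ, |√(m : ℝ) * (Real.exp (x / 2) * (1 / 2))| •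
      ((√(m : ℝ) * Real.exp (x / 2)) ^ (m - 1) •
        T.indicator (fun r => Real.exp (-r ^ 2 / 2)) (√(m : ℝ) * Real.exp (x / 2)))
      = √m ^ m / 2 * {x | √m * Real.exp (x / 2) ∈ T}.indicator (logGammaDensity (m / 2)) x := by
    intro x
    simp only [smul_eq_mul]
    have hiff : x ∈ {x : ℝ | √m * Real.exp (x / 2) ∈ T} ↔ √m * Real.exp (x / 2) ∈ T := Iff.rfl
    by_cases hx : √m * Real.exp (x / 2) ∈ T
    · rw [Set.indicator_of_mem (hiff.2 hx), Set.indicator_of_mem hx]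
      rw [abs_of_nonneg (by positivity), logGammaDensity]
      have e1 : √(m : ℝ) * (Real.exp (x / 2) * (1 / 2)) * ((√(m : ℝ) * Real.exp (x / 2)) ^ (m - 1) *
          Real.exp (-(√(m : ℝ) * Real.exp (x / 2)) ^ 2 / 2))
          = ((√(m : ℝ) * Real.exp (x / 2)) ^ (m - 1) * (√(m : ℝ) * Real.exp (x / 2))) / 2 *
            Real.exp (-(√(m : ℝ) * Real.exp (x / 2)) ^ 2 / 2) := by ring
      rw [e1, pow_sub_one_mul (by omega), mul_pow, mul_pow, Real.sq_sqrt hm0.le, ← Real.exp_nat_mul,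
        ← Real.exp_nat_mul, mul_div_right_comm, mul_assoc, ← Real.exp_add]
      congr 2
      push_cast
      rw [mul_div_cancel₀ x two_ne_zero]
      ring
    · rw [Set.indicator_of_notMem (hiff.not.2 hx), Set.indicator_of_notMem hx]
      simp
  simp_rw [hfun]
  rw [integral_const_mul]
  simp only [nsmul_eq_mul, smul_eq_mul]
  ring

/-- The chi-square tail bound in dimension `m`. -/
theorem stdGaussian_norm_sq_tail_euclidean {m : ℕ} (hm : 1 ≤ m) {s : ℝ} (hs : 1 ≤ s) :
    stdGaussian (EuclideanSpace ℝ (Fin m)) {z | m * s ≤ ‖z‖ ^ 2}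
      ≤ ENNReal.ofReal (Real.exp (-((m : ℝ) / 2 * (s - 1 - Real.log s))) / max 2 ((s - 1) / 2))
          := by
  have hm0 : (0 : ℝ) < m := by exact_mod_cast hm
  have hs0 : 0 < s := by linarith
  have ha : (1 : ℝ) / 2 ≤ m / 2 := by
    have : (1 : ℝ) ≤ m := by exact_mod_cast hm
    linarith
  obtain ⟨K, hK⟩ := exists_stdGaussian_norm_law hm
  have huniv := hK Set.univ MeasurableSet.univ
  simp only [Set.mem_univ, Set.ofPred_true, Set.indicator_univ, probReal_univ] at huniv
  have hD : 0 ≤ ∫ x, logGammaDensity (m / 2) x := integral_nonneg fun x => (Real.exp_pos _).le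
  have hK0 : 0 ≤ K := by
    by_contra h
    push Not at h
    nlinarith
  have hset : {z : EuclideanSpace ℝ (Fin m) | m * s ≤ ‖z‖ ^ 2}
      = {z | ‖z‖ ∈ Set.Ici (√(m * s))} := by
    ext z
    simp only [Set.mem_ofPred_eq, Set.mem_Ici]
    exact (Real.sqrt_le_left (norm_nonneg z)).symm
  have hset' : {x : ℝ | √m * Real.exp (x / 2) ∈ Set.Ici (√(m * s))} = Set.Ici (Real.log s) := by
    ext x
    rw [Set.mem_ofPred_eq, Set.mem_Ici, Set.mem_Ici, Real.sqrt_mul hm0.le,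
      mul_le_mul_iff_right₀ (Real.sqrt_pos.2 hm0), Real.exp_half,
          Real.sqrt_le_sqrt_iff (Real.exp_pos x).le,
      Real.log_le_iff_le_exp hs0]
  rw [hset, ← ofReal_measureReal, hK _ measurableSet_Ici, hset',
      integral_indicator measurableSet_Ici,
    integral_Ici_eq_integral_Ioi]
  refine ENNReal.ofReal_le_ofReal ?_
  calc K * ∫ x in Set.Ioi (Real.log s), logGammaDensity (m / 2) x
      ≤ K * (Real.exp (-((m : ℝ) / 2 * (s - 1 - Real.log s))) / max 2 ((s - 1) / 2)
        * ∫ x, logGammaDensity (m / 2) x) := by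
        gcongr
        exact integral_logGammaDensity_tail ha hs
    _ = Real.exp (-((m : ℝ) / 2 * (s - 1 - Real.log s))) / max 2 ((s - 1) / 2)
        * (K * ∫ x, logGammaDensity (m / 2) x) := by ring
    _ = _ := by rw [← huniv, mul_one]

section Linear

variable {E : Type*} [NormedAddCommGroup E] [InnerProductSpace ℝ E] [FiniteDimensional ℝ E]
  [MeasurableSpace E] [BorelSpace E]

theorem stdGaussian_norm_sq_tail (hm : 1 ≤ Module.finrank ℝ E) {s : ℝ} (hs : 1 ≤ s) :
    stdGaussian E {z | Module.finrank ℝ E * s ≤ ‖z‖ ^ 2}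
      ≤ ENNReal.ofReal (Real.exp (-((Module.finrank ℝ E : ℝ) / 2 * (s - 1 - Real.log s)))
        / max 2 ((s - 1) / 2)) := by
  have h := stdGaussian_norm_sq_tail_euclidean hm hs
  have hmeas : Measurable (stdOrthonormalBasis ℝ E).repr :=
    (stdOrthonormalBasis ℝ E).repr.continuous.measurable
  rw [← stdGaussian_map (stdOrthonormalBasis ℝ E).repr, Measure.map_apply hmeas] at h
  · simpa using h
  · exact measurableSet_le measurable_const (by fun_prop)

/-- The orthogonal projection of a standard Gaussian vector to a subspace is standard Gaussian. -/
theorem stdGaussian_map_orthogonalProjection (U : Submodule ℝ E) :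
    (stdGaussian E).map U.orthogonalProjectionOnto = stdGaussian U := by
  apply Measure.ext_of_charFun
  ext t
  rw [charFun_stdGaussian, charFun_apply, integral_map (by fun_prop) (by fun_prop)]
  have : ∀ x : E, ⟪U.orthogonalProjectionOnto x, t⟫ = ⟪x, (t : E)⟫ := fun x =>
    Submodule.inner_orthogonalProjectionOnto_eq_of_mem_right t x
  simp_rw [this]
  rw [← charFun_apply, charFun_stdGaussian]
  simp

theorem stdGaussian_projection_tail (U : Submodule ℝ E) {m : ℕ} (hm : 1 ≤ m)
    (hU : Module.finrank ℝ U = m) {s : ℝ} (hs : 1 ≤ s) :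
    stdGaussian E {z | m * s ≤ ‖U.orthogonalProjectionOnto z‖ ^ 2}
      ≤ ENNReal.ofReal (Real.exp (-((m : ℝ) / 2 * (s - 1 - Real.log s))) / max 2 ((s - 1) / 2))
          := by
  have h := stdGaussian_norm_sq_tail (E := U) (by rw [hU]; exact hm) hs
  have hmeas : Measurable U.orthogonalProjectionOnto :=
      U.orthogonalProjectionOnto.continuous.measurable
  rw [← stdGaussian_map_orthogonalProjection, Measure.map_apply hmeas
    (measurableSet_le measurable_const (by fun_prop)), hU] at h
  exact h

theorem stdGaussian_inner_tail {a : E} {ρ t : ℝ} (hρ : 0 < ρ) (ha : ‖a‖ ≤ ρ) (ht : 0 < t) :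
    stdGaussian E {z | t * ρ ≤ ⟪a, z⟫}
      ≤ ENNReal.ofReal (Real.exp (-(t ^ 2 / 2)) / max 2 t) := by
  by_cases h0 : a = 0
  · have : {z : E | t * ρ ≤ ⟪a, z⟫} = ∅ := by
      ext z
      simp only [h0, inner_zero_left, Set.mem_ofPred_eq, Set.mem_empty_iff_false, iff_false, not_le]
      positivity
    rw [this, measure_empty]
    exact zero_le
  have ha0 : 0 < ‖a‖ := norm_pos_iff.2 h0
  set L : StrongDual ℝ E := innerSL ℝ (‖a‖⁻¹ • a) with hL
  have hLn : ‖L‖ = 1 := by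
    rw [hL, innerSL_apply_norm, norm_smul, norm_inv, norm_norm, inv_mul_cancel₀ ha0.ne']
  have hmap : (stdGaussian E).map L = gaussianReal 0 1 := by
    rw [IsGaussian.map_eq_gaussianReal, variance_dual_stdGaussian, hLn]
    simp
  have hsub : {z : E | t * ρ ≤ ⟪a, z⟫} ⊆ L ⁻¹' Set.Ici t := by
    intro z hz
    simp only [Set.mem_ofPred_eq] at hz
    simp only [Set.mem_preimage, Set.mem_Ici, hL, innerSL_apply_apply, real_inner_smul_left]
    rw [← div_eq_inv_mul, le_div_iff₀ ha0]
    exact (mul_le_mul_of_nonneg_left ha ht.le).trans hz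
  refine (measure_mono hsub).trans ?_
  rw [← Measure.map_apply (by fun_prop) measurableSet_Ici, hmap]
  exact gaussianReal_Ici_le ht.le

end Linear

/-- The error distribution is that of a scaled standard Gaussian vector. -/
theorem multivariateGaussian_sq_smul_one {n : ℕ} (σ : ℝ) :
    multivariateGaussian 0 (σ ^ 2 • (1 : Matrix (Fin n) (Fin n) ℝ))
      = (stdGaussian (EuclideanSpace ℝ (Fin n))).map fun z => σ • z := by
  apply Measure.ext_of_charFun
  ext t
  rw [charFun_multivariateGaussian (PosSemidef.one.smul (sq_nonneg σ)), charFun_map_smul,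
    charFun_stdGaussian, norm_smul, ← Complex.ofReal_pow, mul_pow,
    EuclideanSpace.real_norm_sq_eq]
  simp only [inner_zero_right, Complex.ofReal_zero, zero_mul, zero_sub, smul_mulVec, one_mulVec,
    dotProduct, Pi.smul_apply, smul_eq_mul, Real.norm_eq_abs, sq_abs]
  rw [Finset.mul_sum]
  congr 1
  push_cast
  rw [neg_div]
  congr 2
  exact Finset.sum_congr rfl fun i _ => by ring

end Tails

/-! ### The oracle estimator and the noise -/

section Oracle

variable {n p : ℕ} {X : Matrix (Fin n) (Fin p) ℝ}

theorem norm_xcol_sq (j : Fin p) : ‖xcol X j‖ ^ 2 = ∑ i, X i j ^ 2 := by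
  rw [EuclideanSpace.real_norm_sq_eq]; rfl

theorem fit_single (j : Fin p) (t : ℝ) : fit X (Pi.single j t) = t • xcol X j := by
  rw [fit_eq_sum, Finset.sum_eq_single j] <;> simp +contextual

/-- The residual of the oracle is orthogonal to the columns of its support. -/
theorem IsOracleLSE.normal_equations {y : Fin n → ℝ} {B : Finset (Fin p)} {bo : Fin p → ℝ}
    (h : IsOracleLSE X y B bo) {j : Fin p} (hj : j ∈ B) :
    ⟪xcol X j, WithLp.toLp 2 y - fit X bo⟫ = 0 := by
  set r := WithLp.toLp 2 y - fit X bo with hr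
  have hsq : ∀ b : Fin p → ℝ, ∑ i, (y i - (X *ᵥ b) i) ^ 2 = ‖WithLp.toLp 2 y - fit X b‖ ^ 2 := by
    intro b
    rw [EuclideanSpace.real_norm_sq_eq]; rfl
  have hmin : ∀ t : ℝ, ‖r‖ ^ 2 ≤ ‖r - t • xcol X j‖ ^ 2 := by
    intro t
    have := h.2 (bo + Pi.single j t) fun k hk => by
      have : k ≠ j := fun e => hk (e ▸ hj)
      simp [h.1 k hk, this]
    rw [hsq, hsq, map_add, fit_single, ← sub_sub] at this
    exact this
  by_cases hx : xcol X j = 0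
  · rw [hx, inner_zero_left]
  have hx0 : 0 < ‖xcol X j‖ ^ 2 := by have := norm_pos_iff.2 hx; positivity
  have h1 := hmin (⟪xcol X j, r⟫ / ‖xcol X j‖ ^ 2)
  rw [norm_sub_sq_real r, real_inner_smul_right, norm_smul, mul_pow, real_inner_comm (xcol X j) r,
    Real.norm_eq_abs, sq_abs] at h1
  set c := ⟪xcol X j, r⟫
  have h2 : c / ‖xcol X j‖ ^ 2 * c = c ^ 2 / ‖xcol X j‖ ^ 2 := by ring
  have h3 : (c / ‖xcol X j‖ ^ 2) ^ 2 * ‖xcol X j‖ ^ 2 = c ^ 2 / ‖xcol X j‖ ^ 2 := by field_simp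
  rw [h2, h3] at h1
  have h4 : c ^ 2 / ‖xcol X j‖ ^ 2 ≤ 0 := by linarith
  rw [div_le_iff₀ hx0, zero_mul] at h4
  exact pow_eq_zero_iff two_ne_zero |>.1 (le_antisymm h4 (sq_nonneg c))

/-- The span of the columns with index in `A`. -/
noncomputable def colSpan (X : Matrix (Fin n) (Fin p) ℝ) (A : Finset (Fin p)) :
    Submodule ℝ (EuclideanSpace ℝ (Fin n)) :=
  Submodule.span ℝ (Set.range fun j : A => xcol X j)

/-- The part of the span of the columns in `A` that is orthogonal to the columns in `B`. -/
noncomputable def extraSpan (X : Matrix (Fin n) (Fin p) ℝ) (A B : Finset (Fin p)) :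
    Submodule ℝ (EuclideanSpace ℝ (Fin n)) :=
  (colSpan X B)ᗮ ⊓ colSpan X A

theorem xcol_mem_colSpan {A : Finset (Fin p)} {j : Fin p} (hj : j ∈ A) : xcol X j ∈ colSpan X A :=
  Submodule.subset_span ⟨⟨j, hj⟩, rfl⟩

theorem fit_mem_colSpan {A : Finset (Fin p)} {b : Fin p → ℝ} (hb : ∀ j ∉ A, b j = 0) :
    fit X b ∈ colSpan X A := by
  rw [fit_eq_sum]
  refine Submodule.sum_mem _ fun j _ => ?_
  by_cases hj : j ∈ A
  · exact Submodule.smul_mem _ _ (xcol_mem_colSpan hj)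
  · simp [hb j hj]

theorem mem_colSpan_orthogonal {A : Finset (Fin p)} {r : EuclideanSpace ℝ (Fin n)}
    (hr : ∀ j ∈ A, ⟪xcol X j, r⟫ = 0) : r ∈ (colSpan X A)ᗮ := by
  rw [Submodule.mem_orthogonal]
  intro w hw
  induction hw using Submodule.span_induction with
  | mem x hx => obtain ⟨j, rfl⟩ := hx; exact hr j j.2
  | zero => exact inner_zero_left _
  | add x y _ _ hx hy => rw [inner_add_left, hx, hy, add_zero]
  | smul c x _ hx => rw [real_inner_smul_left, hx, mul_zero]

variable {dS : ℕ} {cL cU : ℝ}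

theorem SparseRiesz.finrank_extraSpan (h : SparseRiesz X dS cL cU) (hcL : 0 < cL)
    {A B : Finset (Fin p)} (hBA : B ⊆ A) (hA : A.card = dS) :
    Module.finrank ℝ (extraSpan X A B) = dS - B.card := by
  have hle : colSpan X B ≤ colSpan X A := by
    refine Submodule.span_le.2 ?_
    rintro _ ⟨j, rfl⟩
    exact xcol_mem_colSpan (hBA j.2)
  have h1 := Submodule.finrank_add_inf_finrank_orthogonal hle
  have hfin : ∀ C : Finset (Fin p), C.card ≤ dS → Module.finrank ℝ (colSpan X C) = C.card := by
    intro C hC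
    rw [colSpan, finrank_span_eq_card (h.linearIndependent hcL hC), Fintype.card_coe]
  rw [hfin A hA.le, hfin B ((Finset.card_le_card hBA).trans hA.le), hA] at h1
  rw [extraSpan]
  omega

theorem corr_eq_zero_iff (hn : 0 < n) {v : EuclideanSpace ℝ (Fin n)} {j : Fin p} :
    corr X v j = 0 ↔ ⟪xcol X j, v⟫ = 0 := by
  have : (n : ℝ) ≠ 0 := by positivity
  simp [corr, this]

/-- In the least squares fit on `A` beyond the one on `B ⊆ A` only the projection of the noise to
`extraSpan X A B` is visible. -/
theorem fit_eq_projection_noise (hn : 0 < n) {A B : Finset (Fin p)} (hBA : B ⊆ A)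
    {y ε : EuclideanSpace ℝ (Fin n)} {β bo e : Fin p → ℝ} (hβ : ∀ j ∉ B, β j = 0)
    (hy : y = fit X β + ε) (hbo : ∀ j ∉ B, bo j = 0)
    (hbo' : ∀ j ∈ B, corr X (y - fit X bo) j = 0) (he : ∀ j ∉ A, e j = 0)
    (he' : ∀ j ∈ A, corr X (y - fit X bo - fit X e) j = 0) :
    ((extraSpan X A B).orthogonalProjectionOnto ε : EuclideanSpace ℝ (Fin n)) = fit X e := by
  have h1 : fit X e ∈ (colSpan X B)ᗮ := by
    refine mem_colSpan_orthogonal fun j hj => ?_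
    have h2 := he' j (hBA hj)
    rw [corr_sub, hbo' j hj, zero_sub, neg_eq_zero] at h2
    exact (corr_eq_zero_iff hn).1 h2
  refine Submodule.eq_starProjection_of_mem_of_inner_eq_zero ⟨h1, fit_mem_colSpan he⟩ fun w hw => ?_
  have h3 : ε - fit X e = (y - fit X bo - fit X e) - fit X (β - bo) := by
    rw [hy, map_sub]; abel
  have h4 : fit X (β - bo) ∈ colSpan X B := fit_mem_colSpan fun j hj => by simp [hβ j hj, hbo j hj]
  have h5 : y - fit X bo - fit X e ∈ (colSpan X A)ᗮ :=
    mem_colSpan_orthogonal fun j hj => (corr_eq_zero_iff hn).1 (he' j hj)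
  rw [h3, inner_sub_left, Submodule.inner_right_of_mem_orthogonal h4 hw.1,
    Submodule.inner_left_of_mem_orthogonal hw.2 h5, sub_zero]

/-- The residual score of the oracle at any column is a linear functional of the noise, of norm at
most the norm of the column. -/
theorem SparseRiesz.exists_residual_functional (h : SparseRiesz X dS cL cU) (hcL : 0 < cL)
    (hn : 0 < n) {B : Finset (Fin p)} (hB : B.card ≤ dS) (j : Fin p) :
    ∃ a : EuclideanSpace ℝ (Fin n), ‖a‖ ≤ ‖xcol X j‖ ∧
      ∀ (ε : EuclideanSpace ℝ (Fin n)) (β bo : Fin p → ℝ), (∀ k ∉ B, β k = 0) →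
        (∀ k ∉ B, bo k = 0) → (∀ k ∈ B, ⟪xcol X k, fit X β + ε - fit X bo⟫ = 0) →
        ⟪xcol X j, fit X β + ε - fit X bo⟫ = ⟪a, ε⟫ := by
  obtain ⟨c, hc, hc'⟩ := h.exists_corr_eq hcL hB (corr X (xcol X j))
  have hperp : ∀ k ∈ B, ⟪xcol X k, xcol X j - fit X c⟫ = 0 := fun k hk =>
    (corr_eq_zero_iff hn).1 (by rw [corr_sub, hc' k hk, sub_self])
  have hfit : ∀ b : Fin p → ℝ, (∀ k ∉ B, b k = 0) → ∀ r : EuclideanSpace ℝ (Fin n),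
      (∀ k ∈ B, ⟪xcol X k, r⟫ = 0) → ⟪fit X b, r⟫ = 0 := by
    intro b hb r hr
    rw [inner_fit_of_support hb]
    exact Finset.sum_eq_zero fun k hk => by rw [hr k hk, mul_zero]
  refine ⟨xcol X j - fit X c, ?_, fun ε β bo hβ hbo hr => ?_⟩
  · have h1 : ‖xcol X j‖ ^ 2 = ‖xcol X j - fit X c‖ ^ 2 + ‖fit X c‖ ^ 2 := by
      conv_lhs => rw [← sub_add_cancel (xcol X j) (fit X c)]
      rw [norm_add_sq_real, real_inner_comm, hfit c hc _ hperp]; ring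
    refine le_of_sq_le_sq ?_ (norm_nonneg _)
    nlinarith [sq_nonneg ‖fit X c‖]
  · have h2 : ⟪xcol X j, fit X β + ε - fit X bo⟫
        = ⟪xcol X j - fit X c, fit X β + ε - fit X bo⟫ := by
      rw [inner_sub_left, hfit c hc _ hr, sub_zero]
    have h3 : ⟪xcol X j - fit X c, fit X (β - bo)⟫ = 0 := by
      rw [real_inner_comm]
      exact hfit _ (fun k hk => by simp [hβ k hk, hbo k hk]) _ hperp
    rw [h2, show fit X β + ε - fit X bo = ε + fit X (β - bo) by rw [map_sub]; abel,
      inner_add_right, h3, add_zero]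

/-- The estimation error of each oracle coefficient is a linear functional of the noise, whose
squared norm is at most `w° / n`. -/
theorem SparseRiesz.exists_error_functional (h : SparseRiesz X dS cL cU) (hcL : 0 < cL)
    (hn : 0 < n) {B : Finset (Fin p)} (hB : B.card ≤ dS) {j : Fin p} (hj : j ∈ B) :
    ∃ a : EuclideanSpace ℝ (Fin n), a ≠ 0 ∧ ‖a‖ ≤ √(maxDiagInv X B / n) ∧
      ∀ (ε : EuclideanSpace ℝ (Fin n)) (β bo : Fin p → ℝ), (∀ k ∉ B, β k = 0) →
        (∀ k ∉ B, bo k = 0) → (∀ k ∈ B, ⟪xcol X k, fit X β + ε - fit X bo⟫ = 0) →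
        bo j = β j + ⟪a, ε⟫ := by
  have hn0 : (0 : ℝ) < n := by exact_mod_cast hn
  obtain ⟨w, hw, hw'⟩ := h.exists_corr_eq hcL hB (Pi.single j 1)
  set a := (n : ℝ)⁻¹ • fit X w with ha
  have hinner : ∀ b : Fin p → ℝ, (∀ k ∉ B, b k = 0) → ⟪a, fit X b⟫ = b j := by
    intro b hb
    rw [ha, real_inner_smul_left, real_inner_comm, inner_fit_of_support hb, Finset.mul_sum,
      Finset.sum_eq_single_of_mem j hj]
    · have := hw' j hj
      rw [corr, Pi.single_eq_same, div_eq_one_iff_eq hn0.ne'] at this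
      rw [this]; field_simp
    · intro k hk hkj
      have := hw' k hk
      rw [Pi.single_eq_of_ne hkj, corr_eq_zero_iff hn] at this
      rw [this, mul_zero, mul_zero]
  have hMw : subGram X B *ᵥ (restr B w).ofLp = Pi.single ⟨j, hj⟩ 1 := by
    ext k
    have h1 := subGram_restr (X := X) hw k
    rw [hw' k k.2] at h1
    refine (Eq.trans ?_ h1).trans ?_
    · rfl
    · simp only [Pi.single_apply, Subtype.ext_iff]
  have hunit : IsUnit (subGram X B).det := by
    rw [← Matrix.isUnit_iff_isUnit_det, ← Matrix.mulVec_injective_iff_isUnit]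
    refine (injective_iff_map_eq_zero (subGram X B).mulVecLin).2 fun u hu => ?_
    obtain ⟨b, hb, hbu⟩ := exists_restr_eq (WithLp.toLp 2 u : EuclideanSpace ℝ B)
    have h1 := inner_subGram_restr (X := X) hb
    have h2 : Matrix.toEuclideanLin (subGram X B) (restr B b) = 0 := by
      rw [hbu]; ext k; exact congrFun hu k
    rw [h2, inner_zero_left] at h1
    have h3 := h.eq_zero_of_fit hcL hB hb h1.symm.le
    ext k
    have h4 := congrArg (fun v : EuclideanSpace ℝ B => v k) hbu
    rw [h3] at h4
    exact h4.symm
  have hwj : w j = (subGram X B)⁻¹ ⟨j, hj⟩ ⟨j, hj⟩ := by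
    have h1 : (restr B w).ofLp = (subGram X B)⁻¹ *ᵥ Pi.single ⟨j, hj⟩ 1 := by
      rw [← hMw, mulVec_mulVec, nonsing_inv_mul _ hunit, one_mulVec]
    have h2 := congrFun h1 ⟨j, hj⟩
    rw [mulVec_single_one] at h2
    exact h2
  have hnorm : ‖a‖ ^ 2 = w j / n := by
    rw [← real_inner_self_eq_norm_sq]
    conv_lhs => rw [ha, real_inner_smul_right, ← ha, hinner w hw]
    ring
  refine ⟨a, ?_, ?_, fun ε β bo hβ hbo hr => ?_⟩
  · intro h0
    have := hinner (Pi.single j 1) fun k hk => 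
      Pi.single_eq_of_ne (fun e : k = j => hk (e ▸ hj)) _
    rw [h0, inner_zero_left, Pi.single_eq_same] at this
    exact zero_ne_one this
  · refine Real.le_sqrt_of_sq_le ?_
    rw [hnorm, hwj]
    gcongr
    exact le_ciSup (f := fun k : B => (subGram X B)⁻¹ k k) (Set.finite_range _).bddAbove ⟨j, hj⟩
  · have h1 : ⟪a, fit X β + ε - fit X bo⟫ = 0 := by
      rw [ha, real_inner_smul_left, inner_fit_of_support hw,
        Finset.sum_eq_zero fun k hk => by rw [hr k hk, mul_zero], mul_zero]
    rw [inner_sub_right, inner_add_right, hinner β hβ, hinner bo hbo] at h1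
    linarith

end Oracle

section Noise

variable {Ω : Type*} [MeasurableSpace Ω] {P : Measure Ω} {n : ℕ} {σ : ℝ}
  {noise : Ω → EuclideanSpace ℝ (Fin n)}

theorem noise_measure_eq
    (h : HasLaw noise (multivariateGaussian 0 (σ ^ 2 • (1 : Matrix (Fin n) (Fin n) ℝ))) P)
    {T : Set (EuclideanSpace ℝ (Fin n))} (hT : MeasurableSet T) :
    P {ω | noise ω ∈ T} = stdGaussian (EuclideanSpace ℝ (Fin n)) {z | σ • z ∈ T} := by
  have h1 : P.map noise T = P {ω | noise ω ∈ T} :=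
      Measure.map_apply_of_aemeasurable h.aemeasurable hT
  rw [← h1, h.map_eq, multivariateGaussian_sq_smul_one, Measure.map_apply (by fun_prop) hT]
  rfl

theorem noise_inner_tail
    (h : HasLaw noise (multivariateGaussian 0 (σ ^ 2 • (1 : Matrix (Fin n) (Fin n) ℝ))) P)
    (hσ : 0 < σ) {a : EuclideanSpace ℝ (Fin n)} {ρ t : ℝ} (hρ : 0 < ρ) (ha : ‖a‖ ≤ ρ) (ht : 0 < t) :
    P {ω | t * (σ * ρ) ≤ ⟪a, noise ω⟫} ≤ ENNReal.ofReal (Real.exp (-(t ^ 2 / 2)) / max 2 t) := by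
  have hT : MeasurableSet {v : EuclideanSpace ℝ (Fin n) | t * (σ * ρ) ≤ ⟪a, v⟫} :=
    measurableSet_le measurable_const (by fun_prop)
  refine (noise_measure_eq h hT).le.trans (le_trans (measure_mono fun z hz => ?_)
    (stdGaussian_inner_tail hρ ha ht))
  have hz' : t * (σ * ρ) ≤ ⟪a, σ • z⟫ := hz
  rw [real_inner_smul_right] at hz'
  have : σ * (t * ρ) ≤ σ * ⟪a, z⟫ := by linarith
  exact le_of_mul_le_mul_left this hσ

theorem noise_projection_tail
    (h : HasLaw noise (multivariateGaussian 0 (σ ^ 2 • (1 : Matrix (Fin n) (Fin n) ℝ))) P)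
    (hσ : 0 < σ) (U : Submodule ℝ (EuclideanSpace ℝ (Fin n))) {m : ℕ} (hm : 1 ≤ m)
    (hU : Module.finrank ℝ U = m) {s : ℝ} (hs : 1 ≤ s) :
    P {ω | m * (σ ^ 2 * s) ≤ ‖U.orthogonalProjectionOnto (noise ω)‖ ^ 2}
      ≤ ENNReal.ofReal (Real.exp (-((m : ℝ) / 2 * (s - 1 - Real.log s))) / max 2 ((s - 1) / 2))
          := by
  have hT : MeasurableSet {v : EuclideanSpace ℝ (Fin n) |
      m * (σ ^ 2 * s) ≤ ‖U.orthogonalProjectionOnto v‖ ^ 2} :=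
    measurableSet_le measurable_const (by fun_prop)
  refine (noise_measure_eq h hT).le.trans (le_trans (measure_mono fun z hz => ?_)
    (stdGaussian_projection_tail U hm hU hs))
  have hz' : m * (σ ^ 2 * s) ≤ ‖U.orthogonalProjectionOnto (σ • z)‖ ^ 2 := hz
  rw [map_smul, norm_smul, mul_pow, Real.norm_eq_abs, sq_abs] at hz'
  have : σ ^ 2 * (m * s) ≤ σ ^ 2 * ‖U.orthogonalProjectionOnto z‖ ^ 2 := by linarith
  exact le_of_mul_le_mul_left this (by positivity)

end Noise

/-! ### The union bound -/

section Bound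

variable {Ω : Type*} [MeasurableSpace Ω] {P : Measure Ω} {n p : ℕ}
  {X : Matrix (Fin n) (Fin p) ℝ} {β : Fin p → ℝ} {σ : ℝ}
  {noise : Ω → EuclideanSpace ℝ (Fin n)} {dS : ℕ} {cL cU γ ε lam2 : ℝ}
  {lamHat : Ω → ℝ} {betaHat oracle : Ω → Fin p → ℝ}

/-- The sparse Riesz condition excludes an empty sample. -/
theorem Setting.n_pos (h : Setting P X β σ noise dS cL cU γ ε lam2 lamHat betaHat oracle) :
    0 < n := by
  by_contra h0
  obtain rfl : n = 0 := by omega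
  have hp : 0 < p := h.rank_pos.trans h.rank_le
  have h1 := h.sparse_riesz.le_norm_fit h.cL_pos (A := {⟨0, hp⟩})
    (by rw [Finset.card_singleton]; exact h.rank_pos) (c := Pi.single ⟨0, hp⟩ 1)
    (fun j hj => Pi.single_eq_of_ne (by simpa using hj) _)
  simp at h1
  linarith [h.cL_pos]

theorem Setting.card_bounds (h : Setting P X β σ noise dS cL cU γ ε lam2 lamHat betaHat oracle) :
    (supp β).card < dS ∧
      ((supp β).card : ℝ) * (cU / cL - 1 / 2) ≤ (dS - (supp β).card : ℕ) := by
  have hk : 1 ≤ cU / cL := (one_le_div h.cL_pos).2 h.cL_le_cU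
  have h1 := h.sparsity
  rw [le_div_iff₀ (by linarith)] at h1
  have hlt : (supp β).card < dS := by
    have hd : (1 : ℝ) ≤ dS := by exact_mod_cast h.rank_pos
    have hc : (0 : ℝ) ≤ (supp β).card := by positivity
    have : ((supp β).card : ℝ) < dS := by nlinarith
    exact_mod_cast this
  refine ⟨hlt, ?_⟩
  rw [Nat.cast_sub hlt.le]
  linarith

/-- The curvature condition: on sparse vectors the loss is at least twice as convex as the penalty
is concave. -/
theorem Setting.two_le (h : Setting P X β σ noise dS cL cU γ ε lam2 lamHat betaHat oracle) :
    2 ≤ cL * γ := by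
  have hcL := h.cL_pos
  have hcU : 0 < cU := hcL.trans_le h.cL_le_cU
  have h2 : 2 ≤ √(4 + cL / cU) := by
    refine Real.le_sqrt_of_sq_le ?_
    have : 0 ≤ cL / cU := by positivity
    linarith
  have h3 := mul_le_mul_of_nonneg_left h.gamma_ge hcL.le
  rw [mul_inv_cancel_left₀ hcL.ne'] at h3
  linarith

theorem Setting.isPTilde (h : Setting P X β σ noise dS cL cU γ ε lam2 lamHat betaHat oracle) :
    IsPTilde p (supp β).card (dS - (supp β).card) ε
      (pTilde p (supp β).card (dS - (supp β).card) ε) :=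
  (isPTilde_iff (Nat.sub_le_sub_right h.rank_le _) h.eps_pos h.eps_le_one _).2 rfl

theorem mem_supp {j : Fin p} : j ∈ supp β ↔ β j ≠ 0 := by simp [supp]

theorem notMem_supp {j : Fin p} : j ∉ supp β ↔ β j = 0 := by simp [supp]

/-- The deterministic part of the argument: outside the exceptional events for the noise, MC+ at a
level of the good range equals the oracle and has the correct signs. -/
theorem Setting.eq_oracle_and_sign
    (h : Setting P X β σ noise dS cL cU γ ε lam2 lamHat betaHat oracle)
    (hlam1 : 0 < lamOne n p (supp β).card σ ε)
    {e : EuclideanSpace ℝ (Fin n)} {lam : ℝ} {b bo : Fin p → ℝ}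
    (hlam : lam ∈ Set.Icc (lamOne n p (supp β).card σ ε) lam2)
    (hb : IsMCPlus γ X (response X β e) lam b)
    (hbo : IsOracleLSE X (response X β e) (supp β) bo)
    (hoff : ∀ j ∉ supp β, |⟪xcol X j, fit X β + e - fit X bo⟫| < n * lamOne n p (supp β).card σ ε)
    (hon : ∀ j ∈ supp β, γ * lam2 < Real.sign (β j) * bo j)
    (hnoise : ∀ A, supp β ⊆ A → A.card = dS →
      ‖(extraSpan X A (supp β)).orthogonalProjectionOnto e‖ ^ 2
        < (dS - (supp β).card : ℕ) *
          (σ ^ 2 * (2 * Real.log (pTilde p (supp β).card (dS - (supp β).card) ε)))) :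
    b = bo ∧ ∀ j, Real.sign (b j) = Real.sign (β j) := by
  have hn := h.n_pos
  have hn0 : (0 : ℝ) < n := by exact_mod_cast hn
  have hcL := h.cL_pos
  have hcU : 0 < cU := hcL.trans_le h.cL_le_cU
  have hlam0 : 0 < lam := hlam1.trans_le hlam.1
  have hlam20 : 0 < lam2 := hlam0.trans_le hlam.2
  have hγ0 : 0 < γ := by
    have := h.two_le
    by_contra h0
    nlinarith
  have hy : WithLp.toLp 2 (response X β e) = fit X β + e := rfl
  have hne : ∀ j ∈ supp β, ⟪xcol X j, fit X β + e - fit X bo⟫ = 0 := fun j hj =>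
    hbo.normal_equations hj
  have hne' : ∀ j ∈ supp β, corr X (WithLp.toLp 2 (response X β e) - fit X bo) j = 0 :=
    fun j hj => (corr_eq_zero_iff hn).2 (hne j hj)
  have hsign : ∀ j ∈ supp β, Real.sign (bo j) = Real.sign (β j) ∧ γ * lam2 ≤ |bo j| := by
    intro j hj
    have h1 := hon j hj
    have h2 : 0 < γ * lam2 := by positivity
    rcases lt_or_gt_of_ne (mem_supp.1 hj) with h3 | h3
    · rw [Real.sign_of_neg h3] at h1 ⊢
      have h4 : bo j < 0 := by linarith
      rw [abs_of_neg h4]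
      exact ⟨Real.sign_of_neg h4, by linarith⟩
    · rw [Real.sign_of_pos h3] at h1 ⊢
      have h4 : 0 < bo j := by linarith
      rw [abs_of_pos h4]
      exact ⟨Real.sign_of_pos h4, by linarith⟩
  have heq : b = bo := by
    refine h.sparse_riesz.mcPlus_eq_oracle hcL h.cL_le_cU h.two_le h.card_bounds.1 h.card_bounds.2
      hbo.1 hne' (fun j hj => ?_) (fun j hj => (hsign j hj).2) (fun A hBA hA c hc hc' => ?_)
      hlam0 hlam.1 hlam.2 hb
    · rw [corr, hy, abs_div, abs_of_pos hn0, div_lt_iff₀ hn0, mul_comm]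
      exact hoff j hj
    · have h1 := fit_eq_projection_noise hn hBA (fun j hj => notMem_supp.1 hj) hy hbo.1 hne' hc hc'
      have h2 := (hnoise A hBA hA).le
      rw [Submodule.coe_norm, h1] at h2
      set m : ℝ := ((dS - (supp β).card : ℕ) : ℝ)
      set l := Real.log (pTilde p (supp β).card (dS - (supp β).card) ε) with hl
      have hl0 : 0 ≤ l := by linarith [h.isPTilde.2.1]
      have h3 : 2 * √cU * (σ * √(2 / n * l)) ≤ lam2 := (le_max_left _ _).trans h.lam2_ge
      have h4 : (2 * √cU * (σ * √(2 / n * l))) ^ 2 ≤ lam2 ^ 2 :=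
        pow_le_pow_left₀ (by have := h.sigma_pos; positivity) h3 2
      rw [mul_pow, mul_pow, mul_pow, Real.sq_sqrt hcU.le, Real.sq_sqrt (by positivity)] at h4
      rw [div_le_div_iff₀ hn0 (by positivity)]
      have hm0 : 0 ≤ m := Nat.cast_nonneg _
      have h5 := mul_le_mul_of_nonneg_left h4 (mul_nonneg hm0 hn0.le)
      have h6 : m * n * (2 ^ 2 * cU * (σ ^ 2 * (2 / n * l))) =
          m * (σ ^ 2 * (2 * l)) * (4 * cU) := by
        field_simp
        ring
      calc ‖fit X c‖ ^ 2 * (4 * cU) ≤ m * (σ ^ 2 * (2 * l)) * (4 * cU) := by gcongr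
        _ ≤ m * lam2 ^ 2 * n := by linarith
  refine ⟨heq, fun j => ?_⟩
  rw [heq]
  by_cases hj : j ∈ supp β
  · exact (hsign j hj).1
  · rw [hbo.1 j hj, notMem_supp.1 hj]

/-- The union bound. The three terms bound the probabilities that some residual score exceeds
`lamOne`, that some oracle coefficient deviates by `t₂` standard deviations, and that some
projection of the noise is large; each tail bound carries a factor that is at most `1 / 2` and
tends to zero as its threshold tends to infinity. -/
theorem Setting.measure_failure_le
    (h : Setting P X β σ noise dS cL cU γ ε lam2 lamHat betaHat oracle)
    (hlam1 : 0 < lamOne n p (supp β).card σ ε) {t₂ : ℝ} (ht₂ : 0 < t₂)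
    (hcard : (supp β).card * Real.exp (-(t₂ ^ 2 / 2)) ≤ ε)
    (hsig : ∀ j ∈ supp β, t₂ * (σ * √(maxDiagInv X (supp β) / n)) + γ * lam2 ≤ |β j|) :
    P (failure β betaHat oracle)
      ≤ P {ω | lamHat ω ∉ Set.Icc (lamOne n p (supp β).card σ ε) lam2}
        + ENNReal.ofReal (ε * (2 / max 2 √(2 * Real.log (((p : ℝ) - (supp β).card) / ε))
          + 1 / max 2 t₂
          + 1 / max 2 ((2 * Real.log (pTilde p (supp β).card (dS - (supp β).card) ε) - 1) / 2)))
              := by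
  classical
  have hn := h.n_pos
  have hn0 : (0 : ℝ) < n := by exact_mod_cast hn
  have hσ := h.sigma_pos
  have hε := h.eps_pos
  have hcL := h.cL_pos
  have hdS := h.card_bounds.1
  set B := supp β with hB
  set d := B.card with hd
  set m := dS - d with hm
  have hm1 : 1 ≤ m := by omega
  have hm0 : (0 : ℝ) < m := by exact_mod_cast hm1
  have hdp : d < p := hdS.trans_le h.rank_le
  have hpd : (0 : ℝ) < (p : ℝ) - d := by
    have : (d : ℝ) < p := by exact_mod_cast hdp
    linarith
  set L := Real.log (((p : ℝ) - d) / ε) with hL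
  set t₁ := √(2 * L) with ht₁
  set s := 2 * Real.log (pTilde p d m ε) with hs
  have hs1 : 1 ≤ s := h.isPTilde.2.1
  have hlam1eq : n * lamOne n p d σ ε = t₁ * (σ * √n) := by
    have h1 : √(2 / n * L) = √(2 * L) / √n := by
      rw [← Real.sqrt_div' _ hn0.le]; congr 1; ring
    rw [lamOne, ← hL, h1, ← ht₁]
    have h2 : √(n : ℝ) * √n = n := Real.mul_self_sqrt hn0.le
    have h3 : √(n : ℝ) ≠ 0 := by positivity
    field_simp
    linear_combination -(t₁ * h2)
  have ht₁0 : 0 < t₁ := by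
    have h1 : 0 < t₁ * (σ * √n) := by rw [← hlam1eq]; positivity
    exact pos_of_mul_pos_left h1 (by positivity)
  have hL0 : 0 ≤ L := by
    have := Real.sqrt_pos.1 ht₁0
    linarith
  -- the functionals of the noise
  choose a ha ha' using fun j =>
    h.sparse_riesz.exists_residual_functional hcL hn (B := B) hdS.le j
  have hanorm : ∀ j, ‖a j‖ ≤ √n := fun j => (ha j).trans
    (Real.le_sqrt_of_sq_le (by rw [norm_xcol_sq, h.column_norm]))
  choose! c hc0 hc hc' using fun j (hj : j ∈ B) =>
    h.sparse_riesz.exists_error_functional hcL hn hdS.le hj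
  set ρ := √(maxDiagInv X B / n) with hρ
  -- the exceptional events
  set F₀ : Set Ω := {ω | ¬((0 < lamHat ω → IsMCPlus γ X (response X β (noise ω)) (lamHat ω)
    (betaHat ω)) ∧ IsOracleLSE X (response X β (noise ω)) B (oracle ω))} with hF₀
  set F₁ : Set Ω := ⋃ j ∈ Bᶜ, ({ω | t₁ * (σ * √n) ≤ ⟪a j, noise ω⟫} ∪
    {ω | t₁ * (σ * √n) ≤ ⟪-a j, noise ω⟫}) with hF₁
  set F₂ : Set Ω := ⋃ j ∈ B, {ω | t₂ * (σ * ρ) ≤ ⟪-(Real.sign (β j)) • c j, noise ω⟫} with hF₂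
  set F₃ : Set Ω := ⋃ S ∈ Finset.powersetCard m Bᶜ,
    {ω | m * (σ ^ 2 * s) ≤
        ‖(extraSpan X (B ∪ S) B).orthogonalProjectionOnto (noise ω)‖ ^ 2} with hF₃
  have hsub : failure β betaHat oracle ⊆
      {ω | lamHat ω ∉ Set.Icc (lamOne n p d σ ε) lam2} ∪ (F₀ ∪ (F₁ ∪ F₂ ∪ F₃)) := by
    intro ω hω
    by_contra hnot
    simp only [Set.mem_union, not_or] at hnot
    obtain ⟨hl, h0, ⟨h1, h2⟩, h3⟩ := hnot
    have hl' : lamHat ω ∈ Set.Icc (lamOne n p d σ ε) lam2 := not_not.1 hl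
    obtain ⟨hmc, hor⟩ := not_not.1 h0
    have hne : ∀ k ∈ B, ⟪xcol X k, fit X β + noise ω - fit X (oracle ω)⟫ = 0 := fun k hk =>
      hor.normal_equations hk
    have hβB : ∀ k ∉ B, β k = 0 := fun k hk => notMem_supp.1 hk
    have key := h.eq_oracle_and_sign hlam1 hl' (hmc (hlam1.trans_le hl'.1)) hor
      (fun j hj => ?_) (fun j hj => ?_) (fun A hBA hA => ?_)
    · rcases hω with hω | ⟨j, hj⟩
      · exact hω key.1
      · exact hj (key.2 j)
    · rw [ha' j (noise ω) β (oracle ω) hβB hor.1 hne, hlam1eq]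
      by_contra hge
      refine h1 (Set.mem_biUnion (Finset.mem_coe.2 (Finset.mem_compl.2 hj)) ?_)
      rcases le_abs'.1 (not_lt.1 hge) with hle | hle
      · refine Or.inr ?_
        change t₁ * (σ * √n) ≤ ⟪-a j, noise ω⟫
        rw [inner_neg_left]; linarith
      · exact Or.inl hle
    · rw [hc' j hj (noise ω) β (oracle ω) hβB hor.1 hne]
      by_contra hge
      refine h2 (Set.mem_biUnion (Finset.mem_coe.2 hj) ?_)
      change t₂ * (σ * ρ) ≤ ⟪-(Real.sign (β j)) • c j, noise ω⟫
      have hsg := hsig j hj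
      have habs : Real.sign (β j) * β j = |β j| := by
        rcases lt_or_gt_of_ne (mem_supp.1 hj) with h4 | h4
        · rw [Real.sign_of_neg h4, abs_of_neg h4]; ring
        · rw [Real.sign_of_pos h4, abs_of_pos h4]; ring
      rw [real_inner_smul_left]
      rw [not_lt, mul_add, habs] at hge
      linarith
    · by_contra hge
      refine h3 (Set.mem_biUnion (x := A \ B) (Finset.mem_coe.2 (Finset.mem_powersetCard.2 ⟨?_,
          ?_⟩)) ?_)
      · exact fun j hj => Finset.mem_compl.2 (Finset.mem_sdiff.1 hj).2
      · rw [Finset.card_sdiff_of_subset hBA, hA]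
      · change m * (σ ^ 2 * s) ≤
          ‖(extraSpan X (B ∪ A \ B) B).orthogonalProjectionOnto (noise ω)‖ ^ 2
        rw [Finset.union_sdiff_of_subset hBA]
        exact not_lt.1 hge
  have hP₀ : P F₀ = 0 := by
    exact ae_iff.1 (h.mcPlus.and h.oracle_lse)
  have hP₁ : P F₁ ≤ ENNReal.ofReal (ε * (2 / max 2 t₁)) := by
    have hexp : Real.exp (-(t₁ ^ 2 / 2)) = ε / ((p : ℝ) - d) := by
      rw [ht₁, Real.sq_sqrt (by positivity), mul_div_cancel_left₀ _ two_ne_zero, Real.exp_neg, hL,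
        Real.exp_log (by positivity), inv_div]
    refine (measure_biUnion_finset_le _ _).trans ((Finset.sum_le_card_nsmul _ _ _ fun j _ =>
      (measure_union_le _ _).trans (add_le_add
        (noise_inner_tail h.noise_law hσ (Real.sqrt_pos.2 hn0) (hanorm j) ht₁0)
        (noise_inner_tail h.noise_law hσ (Real.sqrt_pos.2 hn0) (by rw [norm_neg]; exact hanorm j)
          ht₁0))).trans (le_of_eq ?_))
    rw [Finset.card_compl, Fintype.card_fin, ← hd, nsmul_eq_mul,
        ← ENNReal.ofReal_add (by positivity)
      (by positivity), ← ENNReal.ofReal_natCast, ← ENNReal.ofReal_mul (by positivity),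
      Nat.cast_sub hdp.le, hexp]
    congr 1
    field_simp
    ring
  have hP₂ : P F₂ ≤ ENNReal.ofReal (ε * (1 / max 2 t₂)) := by
    have hterm : ∀ j ∈ B, P {ω | t₂ * (σ * ρ) ≤ ⟪-(Real.sign (β j)) • c j, noise ω⟫}
        ≤ ENNReal.ofReal (Real.exp (-(t₂ ^ 2 / 2)) / max 2 t₂) := by
      intro j hj
      refine noise_inner_tail h.noise_law hσ ((norm_pos_iff.2 (hc0 j hj)).trans_le (hc j hj)) ?_ ht₂
      rw [norm_smul]
      rcases lt_or_gt_of_ne (mem_supp.1 hj) with h4 | h4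
      · rw [Real.sign_of_neg h4]; simpa using hc j hj
      · rw [Real.sign_of_pos h4]; simpa using hc j hj
    refine (measure_biUnion_finset_le _ _).trans
      ((Finset.sum_le_card_nsmul _ _ _ hterm).trans ?_)
    rw [← hd, nsmul_eq_mul, ← ENNReal.ofReal_natCast, ← ENNReal.ofReal_mul (by positivity)]
    refine ENNReal.ofReal_le_ofReal ?_
    rw [mul_div_assoc', mul_one_div]
    gcongr
  have hP₃ : P F₃ ≤ ENNReal.ofReal (ε * (1 / max 2 ((s - 1) / 2))) := by
    have hterm : ∀ S ∈ Finset.powersetCard m Bᶜ,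
        P {ω | m * (σ ^ 2 * s) ≤ ‖(extraSpan X (B ∪ S) B).orthogonalProjectionOnto (noise ω)‖ ^ 2}
        ≤ ENNReal.ofReal (Real.exp (-((m : ℝ) / 2 * (s - 1 - Real.log s))) / max 2 ((s - 1) / 2))
            := by
      intro S hS
      obtain ⟨hS1, hS2⟩ := Finset.mem_powersetCard.1 hS
      refine noise_projection_tail h.noise_law hσ _ hm1
        (h.sparse_riesz.finrank_extraSpan hcL Finset.subset_union_left ?_) hs1
      rw [Finset.card_union_of_disjoint, hS2]
      · omega
      · exact Finset.disjoint_left.2 fun j hj hjS => Finset.mem_compl.1 (hS1 hjS) hj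
    refine (measure_biUnion_finset_le _ _).trans
      ((Finset.sum_le_card_nsmul _ _ _ hterm).trans (le_of_eq ?_))
    have hch : 0 < (p - d).choose m := Nat.choose_pos (by have := h.rank_le; omega)
    have hch' : (0 : ℝ) < (p - d).choose m := by exact_mod_cast hch
    have hexp : Real.exp (-((m : ℝ) / 2 * (s - 1 - Real.log s))) = ε / (p - d).choose m := by
      have h1 : s - 1 - Real.log s
          = 2 / (m : ℝ) * (Real.log ((p - d).choose m : ℝ) + Real.log (1 / ε)) := h.isPTilde.2.2
      have h2 : (m : ℝ) / 2 * (s - 1 - Real.log s) = Real.log ((p - d).choose m / ε) := by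
        rw [h1, ← Real.log_mul hch'.ne' (by positivity), mul_one_div]
        field_simp
      rw [h2, Real.exp_neg, Real.exp_log (by positivity), inv_div]
    rw [Finset.card_powersetCard, Finset.card_compl, Fintype.card_fin, ← hd, nsmul_eq_mul,
      ← ENNReal.ofReal_natCast, ← ENNReal.ofReal_mul (by positivity), hexp]
    congr 1
    field_simp
  refine (measure_mono hsub).trans ((measure_union_le _ _).trans ?_)
  gcongr
  refine (measure_union_le _ _).trans ?_
  rw [hP₀, zero_add]
  refine (measure_union_le _ _).trans ((add_le_add ((measure_union_le _ _).trans
    (add_le_add hP₁ hP₂)) hP₃).trans (le_of_eq ?_))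
  rw [← ENNReal.ofReal_add (by positivity) (by positivity),
    ← ENNReal.ofReal_add (by positivity) (by positivity)]
  congr 1
  ring

end Bound

/-! ### Selection consistency and oracle efficiency -/

section Consequences

/-- The level `pTilde` decreases in `ε`, so that growth at `ε = 1` gives growth
for every `ε ≤ 1`. -/
theorem pTilde_anti {p d m : ℕ} {ε : ℝ} (hmp : m ≤ p - d) (hε : 0 < ε) (hε1 : ε ≤ 1) :
    pTilde p d m 1 ≤ pTilde p d m ε := by
  obtain ⟨h1, h2, h3⟩ := (isPTilde_iff hmp hε hε1 _).2 rfl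
  obtain ⟨k1, k2, k3⟩ := (isPTilde_iff hmp one_pos le_rfl _).2 rfl
  by_contra hlt
  push Not at hlt
  have hs : 2 * Real.log (pTilde p d m ε) < 2 * Real.log (pTilde p d m 1) := by
    have := Real.log_lt_log h1 hlt
    linarith
  set r := 2 * Real.log (pTilde p d m ε)
  set t := 2 * Real.log (pTilde p d m 1)
  have hle : (2 / (m : ℝ)) * (Real.log ((p - d).choose m : ℝ) + Real.log (1 / 1))
      ≤ (2 / (m : ℝ)) * (Real.log ((p - d).choose m : ℝ) + Real.log (1 / ε)) := by
    have : Real.log (1 / 1) ≤ Real.log (1 / ε) :=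
      Real.log_le_log (by norm_num) (one_div_le_one_div_of_le hε hε1)
    gcongr
  rw [← h3, ← k3] at hle
  -- `x - 1 - log x` is strictly increasing beyond `1`
  have hr : 0 < r := by linarith
  have h5 := Real.log_lt_sub_one_of_pos (show 0 < t / r by positivity)
    (((one_lt_div hr).2 hs).ne')
  rw [Real.log_div (by positivity) hr.ne'] at h5
  have h6 : t / r - 1 ≤ t - r := by
    rw [div_sub_one hr.ne', div_le_iff₀ hr]
    nlinarith
  linarith

theorem failure_union_support_eq {Ω : Type*} {p : ℕ} (β : Fin p → ℝ)
    (betaHat oracle : Ω → Fin p → ℝ) :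
    failure β betaHat oracle ∪ {ω | {j | betaHat ω j ≠ 0} = {j | β j ≠ 0}} = Set.univ := by
  refine Set.eq_univ_of_forall fun ω => ?_
  by_cases hω : ω ∈ failure β betaHat oracle
  · exact Or.inl hω
  · refine Or.inr ?_
    change {j | betaHat ω j ≠ 0} = {j | β j ≠ 0}
    have hs : ∀ j, Real.sign (betaHat ω j) = Real.sign (β j) := by
      intro j
      by_contra hj
      exact hω (Or.inr ⟨j, hj⟩)
    ext j
    change betaHat ω j ≠ 0 ↔ β j ≠ 0
    rw [← Real.sign_eq_zero_iff.ne, hs j, Real.sign_eq_zero_iff.ne]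

variable {Ω : Type*} [MeasurableSpace Ω] {P : Measure Ω} {n p : ℕ}
  {X : Matrix (Fin n) (Fin p) ℝ} {β : Fin p → ℝ} {σ : ℝ}
  {noise : Ω → EuclideanSpace ℝ (Fin n)} {dS : ℕ} {cL cU γ ε lam2 : ℝ}
  {lamHat : Ω → ℝ} {betaHat oracle : Ω → Fin p → ℝ}

theorem Setting.lamOne_pos (h : Setting P X β σ noise dS cL cU γ ε lam2 lamHat betaHat oracle)
    (h1 : ε < (p : ℝ) - (supp β).card) : 0 < lamOne n p (supp β).card σ ε := by
  have hn : (0 : ℝ) < n := by exact_mod_cast h.n_pos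
  have := Real.log_pos ((one_lt_div h.eps_pos).2 h1)
  have hσ := h.sigma_pos
  unfold lamOne
  positivity

theorem Setting.one_le_sub (h : Setting P X β σ noise dS cL cU γ ε lam2 lamHat betaHat oracle) :
    (1 : ℝ) ≤ (p : ℝ) - (supp β).card := by
  have h1 := h.card_bounds.1.trans_le h.rank_le
  have h2 : ((supp β).card : ℝ) + 1 ≤ p := by exact_mod_cast h1
  linarith

theorem Setting.log_ratio_nonneg
    (h : Setting P X β σ noise dS cL cU γ ε lam2 lamHat betaHat oracle) {j : Fin p}
    (hj : j ∈ supp β) : 0 ≤ Real.log ((supp β).card / ε) := by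
  refine Real.log_nonneg ((one_le_div h.eps_pos).2 (h.eps_le_one.trans ?_))
  exact_mod_cast Finset.card_pos.2 ⟨j, hj⟩

/-- The signal condition, with the deviation measured in units of the largest standard deviation of
an oracle coefficient. -/
theorem Setting.signal_ge' (h : Setting P X β σ noise dS cL cU γ ε lam2 lamHat betaHat oracle)
    {j : Fin p} (hj : j ∈ supp β) :
    √(2 * Real.log ((supp β).card / ε)) * (σ * √(maxDiagInv X (supp β) / n)) + γ * lam2 ≤
        |β j| := by
  refine le_trans (le_of_eq ?_) (h.signal_ge j hj)
  have := h.log_ratio_nonneg hj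
  have hsqrt := Real.sqrt_mul' (maxDiagInv X (supp β) / n)
    (show 0 ≤ 2 * Real.log ((supp β).card / ε) by positivity)
  rw [show maxDiagInv X (supp β) * (2 / (n : ℝ)) * Real.log ((supp β).card / ε)
    = maxDiagInv X (supp β) / n * (2 * Real.log ((supp β).card / ε)) by ring, hsqrt]
  ac_rfl

theorem Setting.card_mul_exp_le
    (h : Setting P X β σ noise dS cL cU γ ε lam2 lamHat betaHat oracle) {t : ℝ}
    (ht : √(2 * Real.log ((supp β).card / ε)) ≤ t) :
    (supp β).card * Real.exp (-(t ^ 2 / 2)) ≤ ε := by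
  rcases (supp β).eq_empty_or_nonempty with h0 | ⟨j, hj⟩
  · rw [h0, Finset.card_empty, Nat.cast_zero, zero_mul]
    exact h.eps_pos.le
  have hlog := h.log_ratio_nonneg hj
  have hd : (0 : ℝ) < (supp β).card := by exact_mod_cast Finset.card_pos.2 ⟨j, hj⟩
  have hε := h.eps_pos
  have h1 : 2 * Real.log ((supp β).card / ε) ≤ t ^ 2 := (Real.sqrt_le_left
    ((Real.sqrt_nonneg _).trans ht)).1 ht
  calc (supp β).card * Real.exp (-(t ^ 2 / 2))
      ≤ (supp β).card * Real.exp (-Real.log ((supp β).card / ε)) := by gcongr; linarith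
    _ = ε := by
      rw [Real.exp_neg, Real.exp_log (by positivity)]
      field_simp

/-- The bound of part (i), with a slightly better constant. -/
theorem Setting.measure_failure_le_two_mul
    (h : Setting P X β σ noise dS cL cU γ ε lam2 lamHat betaHat oracle) (hε1 : ε < 1) :
    P (failure β betaHat oracle)
      ≤ P {ω | lamHat ω ∉ Set.Icc (lamOne n p (supp β).card σ ε) lam2}
        + ENNReal.ofReal (2 * ε) := by
  have hε := h.eps_pos
  -- without active coefficients the deviation threshold is immaterial
  obtain ⟨t, ht0, ht, hsig⟩ : ∃ t : ℝ, 0 < t ∧ √(2 * Real.log ((supp β).card / ε)) ≤ t ∧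
      ∀ j ∈ supp β, t * (σ * √(maxDiagInv X (supp β) / n)) + γ * lam2 ≤ |β j| := by
    rcases (supp β).eq_empty_or_nonempty with h0 | ⟨j, hj⟩
    · refine ⟨1, one_pos, by simp [h0], fun j hj => ?_⟩
      simp [h0] at hj
    · refine ⟨_, ?_, le_rfl, fun j hj => h.signal_ge' hj⟩
      have hd : (1 : ℝ) ≤ (supp β).card := by exact_mod_cast Finset.card_pos.2 ⟨j, hj⟩
      have := Real.log_pos ((one_lt_div hε).2 (hε1.trans_le hd))
      positivity
  refine (h.measure_failure_le (h.lamOne_pos (hε1.trans_le h.one_le_sub)) ht0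
    (h.card_mul_exp_le ht) hsig).trans (add_le_add le_rfl (ENNReal.ofReal_le_ofReal ?_))
  have hmax : ∀ x : ℝ, 1 / max 2 x ≤ 1 / 2 := fun x =>
    one_div_le_one_div_of_le two_pos (le_max_left _ _)
  have h1 := hmax √(2 * Real.log (((p : ℝ) - (supp β).card) / ε))
  have h2 := hmax t
  have h3 := hmax ((2 * Real.log (pTilde p (supp β).card (dS - (supp β).card) ε) - 1) / 2)
  rw [show (2 : ℝ) / max 2 √(2 * Real.log (((p : ℝ) - (supp β).card) / ε))
    = 2 * (1 / max 2 √(2 * Real.log (((p : ℝ) - (supp β).card) / ε))) by ring]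
  nlinarith

/-- A quantitative form of the growth condition of part (ii). -/
theorem Setting.measure_failure_le_of_large
    (h : Setting P X β σ noise dS cL cU γ ε lam2 lamHat betaHat oracle) {M : ℝ} (hM : 2 ≤ M)
    (hlarge : M ≤ ε⁻¹ ∨ (M ≤ (p : ℝ) - (supp β).card ∧
      M ≤ pTilde p (supp β).card (dS - (supp β).card) 1 ∧
      ∀ j ∈ supp β, M ≤ √((n : ℝ) / maxDiagInv X (supp β)) * (|β j| - γ * lam2) / σ)) :
    P (failure β betaHat oracle)
      ≤ P {ω | lamHat ω ∉ Set.Icc (lamOne n p (supp β).card σ ε) lam2}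
        + ENNReal.ofReal (2 / M + (2 / √(2 * Real.log M) + 1 / M
          + 1 / ((2 * Real.log M - 1) / 2))) := by
  have hε := h.eps_pos
  have hM0 : 0 < M := by linarith
  have hlogM : Real.log 2 ≤ Real.log M := Real.log_le_log two_pos hM
  have hlog2 := Real.log_two_gt_d9
  have hl1 : 0 < (2 * Real.log M - 1) / 2 := by linarith
  have hl2 : 0 < √(2 * Real.log M) := Real.sqrt_pos.2 (by linarith)
  rcases hlarge with hlarge | ⟨hp, hpt, hs⟩
  · have hεM : ε ≤ 1 / M := by
      rw [le_div_iff₀ hM0, mul_comm, ← le_div_iff₀ hε, one_div]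
      exact hlarge
    have hε1 : ε < 1 := hεM.trans_lt ((div_lt_one hM0).2 (by linarith))
    refine (h.measure_failure_le_two_mul hε1).trans ?_
    gcongr
    have : 2 * ε ≤ 2 / M := by rw [← mul_one_div]; linarith
    refine this.trans (le_add_of_nonneg_right (by positivity))
  · set t := max M √(2 * Real.log ((supp β).card / ε)) with ht
    have hε1 := h.eps_le_one
    have hsig : ∀ j ∈ supp β, t * (σ * √(maxDiagInv X (supp β) / n)) + γ * lam2 ≤ |β j| := by
      intro j hj
      rcases max_choice M √(2 * Real.log ((supp β).card / ε)) with hc | hc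
      · rw [ht, hc]
        have h1 := hs j hj
        have hσ := h.sigma_pos
        have hn : (0 : ℝ) < n := by exact_mod_cast h.n_pos
        rw [le_div_iff₀ hσ] at h1
        have hw : 0 < maxDiagInv X (supp β) := by
          by_contra hw
          rw [Real.sqrt_eq_zero_of_nonpos (div_nonpos_of_nonneg_of_nonpos hn.le (not_lt.1 hw)),
            zero_mul] at h1
          have := mul_pos hM0 hσ
          linarith
        have h2 : √(maxDiagInv X (supp β) / n) * √((n : ℝ) / maxDiagInv X (supp β)) = 1 := by
          rw [← Real.sqrt_mul (by positivity), div_mul_div_cancel₀ hn.ne', div_self hw.ne',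
            Real.sqrt_one]
        have h3 := mul_le_mul_of_nonneg_left h1 (Real.sqrt_nonneg (maxDiagInv X (supp β) / n))
        rw [← mul_assoc, ← mul_assoc, h2, one_mul] at h3
        linarith
      · rw [ht, hc]
        exact h.signal_ge' hj
    refine (h.measure_failure_le (h.lamOne_pos (by linarith)) (hM0.trans_le (le_max_left _ _))
      (h.card_mul_exp_le (le_max_right _ _)) hsig).trans ?_
    gcongr
    have hpM : M ≤ ((p : ℝ) - (supp β).card) / ε := by
      rw [le_div_iff₀ hε]; nlinarith
    have hlp : Real.log M ≤ Real.log (pTilde p (supp β).card (dS - (supp β).card) ε) :=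
      Real.log_le_log hM0 (hpt.trans
        (pTilde_anti (Nat.sub_le_sub_right h.rank_le _) hε hε1))
    have b1 : 2 / max 2 √(2 * Real.log (((p : ℝ) - (supp β).card) / ε)) ≤
        2 / √(2 * Real.log M) := by
      refine div_le_div_of_nonneg_left two_pos.le hl2 (le_trans ?_ (le_max_right _ _))
      gcongr
    have b2 : 1 / max 2 t ≤ 1 / M :=
      one_div_le_one_div_of_le hM0 ((le_max_left _ _).trans (le_max_right _ _))
    have b3 : 1 / max 2 ((2 * Real.log (pTilde p (supp β).card (dS - (supp β).card) ε) - 1) / 2)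
        ≤ 1 / ((2 * Real.log M - 1) / 2) := by
      refine one_div_le_one_div_of_le hl1 (le_trans ?_ (le_max_right _ _))
      linarith
    have hM2 : 0 ≤ 2 / M := by positivity
    refine (mul_le_of_le_one_left (by positivity) hε1).trans ?_
    linarith

theorem tendsto_growth_bound :
    Tendsto (fun M : ℝ => ENNReal.ofReal (2 / M + (2 / √(2 * Real.log M) + 1 / M
      + 1 / ((2 * Real.log M - 1) / 2)))) atTop (𝓝 0) := by
  have hlog : Tendsto (fun M : ℝ => 2 * Real.log M) atTop atTop :=
    Real.tendsto_log_atTop.const_mul_atTop two_pos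
  have h1 : Tendsto (fun M : ℝ => 2 / M) atTop (𝓝 0) := tendsto_const_nhds.div_atTop tendsto_id
  have h2 : Tendsto (fun M : ℝ => 2 / √(2 * Real.log M)) atTop (𝓝 0) :=
    tendsto_const_nhds.div_atTop (Real.tendsto_sqrt_atTop.comp hlog)
  have h3 : Tendsto (fun M : ℝ => 1 / M) atTop (𝓝 0) := tendsto_const_nhds.div_atTop tendsto_id
  have h4 : Tendsto (fun M : ℝ => 1 / ((2 * Real.log M - 1) / 2)) atTop (𝓝 0) :=
    tendsto_const_nhds.div_atTop
      ((tendsto_atTop_add_const_right _ (-1) hlog).atTop_div_const two_pos)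
  have := ENNReal.tendsto_ofReal (h1.add ((h2.add h3).add h4))
  simpa using this

theorem abs_measureReal_sub_le [IsFiniteMeasure P] (S : Set (Fin p → ℝ)) :
    |P.real {ω | betaHat ω ∈ S} - P.real {ω | oracle ω ∈ S}|
      ≤ P.real (failure β betaHat oracle) := by
  have key : ∀ f g : Ω → Fin p → ℝ, (∀ ω, f ω ≠ g ω → ω ∈ failure β betaHat oracle) →
      P.real {ω | f ω ∈ S} - P.real {ω | g ω ∈ S} ≤ P.real (failure β betaHat oracle) := by
    intro f g hfg
    have hsub : {ω | f ω ∈ S} ⊆ {ω | g ω ∈ S} ∪ failure β betaHat oracle := by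
      intro ω hω
      by_cases he : f ω = g ω
      · refine Or.inl ?_
        change g ω ∈ S
        rw [← he]; exact hω
      · exact Or.inr (hfg ω he)
    have := (measureReal_mono hsub (measure_ne_top P _)).trans (measureReal_union_le _ _)
    linarith
  refine abs_le.2 ⟨?_, key _ _ fun ω h => Or.inl h⟩
  have := key oracle betaHat fun ω h => Or.inl h.symm
  linarith

end Consequences

end MCPlus

theorem theorem1 :
    -- the nonasymptotic bound
    (∀ {Ω : Type*} [MeasurableSpace Ω] (P : Measure Ω) [IsProbabilityMeasure P] {n p : ℕ}
        (X : Matrix (Fin n) (Fin p) ℝ) (β : Fin p → ℝ) (σ : ℝ)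
        (noise : Ω → EuclideanSpace ℝ (Fin n)) (dS : ℕ) (cL cU γ ε lam2 : ℝ)
        (lamHat : Ω → ℝ) (betaHat oracle : Ω → Fin p → ℝ),
        MCPlus.Setting P X β σ noise dS cL cU γ ε lam2 lamHat betaHat oracle →
        P (MCPlus.failure β betaHat oracle)
          ≤ P {ω | lamHat ω ∉ Set.Icc (MCPlus.lamOne n p (MCPlus.supp β).card σ ε) lam2}
            + ENNReal.ofReal ((3 / 2 + 1 / Real.sqrt 2) * ε)) ∧
    -- selection consistency and oracle efficiency along a sequence of models
    (∀ {Ω : ℕ → Type*} [∀ k, MeasurableSpace (Ω k)] (P : ∀ k, Measure (Ω k))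
        [∀ k, IsProbabilityMeasure (P k)] (n p : ℕ → ℕ)
        (X : ∀ k, Matrix (Fin (n k)) (Fin (p k)) ℝ) (β : ∀ k, Fin (p k) → ℝ) (σ : ℕ → ℝ)
        (noise : ∀ k, Ω k → EuclideanSpace ℝ (Fin (n k))) (dS : ℕ → ℕ)
        (cL cU γ ε lam2 : ℕ → ℝ)
        (lamHat : ∀ k, Ω k → ℝ) (betaHat oracle : ∀ k, Ω k → Fin (p k) → ℝ),
        (∀ k, MCPlus.Setting (P k) (X k) (β k) (σ k) (noise k) (dS k) (cL k) (cU k) (γ k) (ε k)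
          (lam2 k) (lamHat k) (betaHat k) (oracle k)) →
        (∀ k, AEMeasurable (lamHat k) (P k)) →
        Tendsto (fun k => P k {ω | lamHat k ω ∈
          Set.Icc (MCPlus.lamOne (n k) (p k) (MCPlus.supp (β k)).card (σ k) (ε k)) (lam2 k)})
          atTop (𝓝 1) →
        -- `max (1/ε) (min (p - d°) p̃₁ (√(n/w°) (β_* - γ λ₂) / σ)) → ∞`
        (∀ M : ℝ, ∀ᶠ k in atTop, M ≤ (ε k)⁻¹ ∨
          (M ≤ (p k : ℝ) - (MCPlus.supp (β k)).card ∧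
           M ≤ MCPlus.pTilde (p k) (MCPlus.supp (β k)).card
                 (dS k - (MCPlus.supp (β k)).card) 1 ∧
           ∀ j ∈ MCPlus.supp (β k),
             M ≤ Real.sqrt ((n k : ℝ) / MCPlus.maxDiagInv (X k) (MCPlus.supp (β k)))
                   * (|β k j| - γ k * lam2 k) / σ k)) →
        -- selection consistency
        Tendsto (fun k => P k {ω | {j | betaHat k ω j ≠ 0} = {j | β k j ≠ 0}}) atTop (𝓝 1) ∧
        -- equality with the oracle and correct signs, with probability tending to one
        Tendsto (fun k => P k (MCPlus.failure (β k) (betaHat k) (oracle k))) atTop (𝓝 0) ∧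
        -- hence the two estimators have asymptotically the same distribution
        Tendsto (fun k => ⨆ S : Set (Fin (p k) → ℝ),
          |(P k).real {ω | betaHat k ω ∈ S} - (P k).real {ω | oracle k ω ∈ S}|)
          atTop (𝓝 0)) := by
  refine ⟨?_, ?_⟩
  · intro Ω _ P _ n p X β σ noise dS cL cU γ ε lam2 lamHat betaHat oracle h
    have h2 : (1 : ℝ) / 2 ≤ 1 / √2 := by
      have : √2 ≤ 2 := Real.sqrt_le_left two_pos.le |>.2 (by norm_num)
      exact one_div_le_one_div_of_le (by positivity) this
    rcases h.eps_le_one.eq_or_lt with rfl | hε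
    · refine prob_le_one.trans (le_add_of_nonneg_of_le zero_le ?_)
      rw [ENNReal.one_le_ofReal]
      linarith
    · refine (h.measure_failure_le_two_mul hε).trans ?_
      have := h.eps_pos
      gcongr
      linarith
  · intro Ω _ P _ n p X β σ noise dS cL cU γ ε lam2 lamHat betaHat oracle h hmeas hprob hgrow
    have hbad : Tendsto (fun k => P k {ω | lamHat k ω ∉ Set.Icc
        (MCPlus.lamOne (n k) (p k) (MCPlus.supp (β k)).card (σ k) (ε k)) (lam2 k)})
        atTop (𝓝 0) := by
      have h1 := ENNReal.Tendsto.sub (tendsto_const_nhds (x := (1 : ENNReal))) hprob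
        (Or.inl ENNReal.one_ne_top)
      rw [tsub_self] at h1
      refine h1.congr fun k => ?_
      exact (prob_compl_eq_one_sub₀ ((hmeas k).nullMeasurableSet_preimage measurableSet_Icc)).symm
    have hfail : Tendsto (fun k => P k (MCPlus.failure (β k) (betaHat k) (oracle k)))
        atTop (𝓝 0) := by
      rw [ENNReal.tendsto_nhds_zero] at hbad ⊢
      intro δ hδ
      have hδ2 : 0 < δ / 2 := ENNReal.half_pos hδ.ne'
      obtain ⟨M, hM, hM2⟩ := ((ENNReal.tendsto_nhds_zero.1 MCPlus.tendsto_growth_bound _ hδ2).and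
        (eventually_ge_atTop 2)).exists
      filter_upwards [hbad _ hδ2, hgrow M] with k h1 h2
      calc _ ≤ _ := (h k).measure_failure_le_of_large hM2 h2
        _ ≤ δ / 2 + δ / 2 := add_le_add h1 hM
        _ = δ := ENNReal.add_halves δ
    refine ⟨?_, hfail, ?_⟩
    · have h1 := ENNReal.Tendsto.sub (tendsto_const_nhds (x := (1 : ENNReal))) hfail
        (Or.inl ENNReal.one_ne_top)
      rw [tsub_zero] at h1
      refine tendsto_of_tendsto_of_tendsto_of_le_of_le h1 tendsto_const_nhds (fun k => ?_)
        fun k => prob_le_one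
      change 1 - P k (MCPlus.failure (β k) (betaHat k) (oracle k)) ≤ _
      rw [tsub_le_iff_left, ← measure_univ (μ := P k), ← MCPlus.failure_union_support_eq
        (β k) (betaHat k) (oracle k)]
      exact measure_union_le _ _
    · have h1 := (ENNReal.tendsto_toReal ENNReal.zero_ne_top).comp hfail
      refine tendsto_of_tendsto_of_tendsto_of_le_of_le tendsto_const_nhds h1
        (fun k => Real.iSup_nonneg fun S => abs_nonneg _) fun k => ?_
      exact ciSup_le fun S => MCPlus.abs_measureReal_sub_le S
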